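/- Fix $\alpha\in(1,2]$. For $j\in\mathbb Z$, $k=(k_1,k_2)\in\mathbb Z^2$ and $c=(c_1,c_2)\in(0,\infty)^2$ put \[ A_{2^j}=\mathrm{diag}(2^{j\alpha/2},2^{j/2},2^{j/2}),\qquad S_k=\begin{pmatrix}1&k_1&k_2\\0&1&0\\0&0&1\end{pmatrix},\qquad M_c=\mathrm{diag}(c_1,c_2,c_2), \] and write $|k|\le N$ for $|k_1|\le N$ and $|k_2|\le N$. Let $\hat f(\xi)=\int f(x)e^{-2\pi i\langle\xi,x\rangle}\,dx$ (extended to $L^2$), let \[ \mathcal P=\{\xi\in\mathbb R^3:\ |\xi_1|\ge1,\ |\xi_2/\xi_1|\le1,\ |\xi_3/\xi_1|\le1\},\qquad \check L^2(\mathcal P)=\{f\in L^2(\mathbb R^3):\ \operatorname{supp}\hat f\subset\mathcal P\}. \] For $\psi\in L^2(\mathbb R^3)$ let $\Psi(\psi)=\Psi(\psi;c,\alpha)$ be the family of the functions $\psi_{j,k,m}=2^{j(\alpha+2)/4}\,\psi(S_kA_{2^j}\,\cdot\,-m)$ with $j\in\mathbb N_0$, $k\in\mathbb Z^2$, $|k|\le\lceil2^{j(\alpha-1)/2}\rceil$,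 $m\in M_c\mathbb Z^3$. Put \[ \Phi(\xi,\omega)=\sum_{j\ge0}\ \sum_{|k|\le\lceil2^{j(\alpha-1)/2}\rceil}\bigl|\hat\psi(S_{-k}^TA_{2^{-j}}\xi)\bigr|\,\bigl|\hat\psi(S_{-k}^TA_{2^{-j}}\xi+\omega)\bigr|,\qquad \Gamma(\omega)=\operatorname*{ess\,sup}_{\xi\in\mathcal P}\Phi(\xi,\omega), \] \[ L_{\mathit{inf}}=\operatorname*{ess\,inf}_{\xi\in\mathcal P}\Phi(\xi,0),\quad L_{\mathit{sup}}=\operatorname*{ess\,sup}_{\xi\in\mathcal P}\Phi(\xi,0),\quad R(c)=\sum_{m\in\mathbb Z^3\setminus\{0\}}\bigl[\Gamma(M_c^{-1}m)\,\Gamma(-M_c^{-1}m)\bigr]^{1/2}. \] Let $K,L\in\mathbb N$ with $L\ge10$ and $\frac{3L}2\le K\le3L-2$. Let $m_0,m_1:\mathbb R\to\mathbb C$ be measurable functions such that for all $\xi\in\mathbb R$ \[ |m_0(\xi)|^2=(\cos\pi\xi)^{2K}\sum_{n=0}^{L-1}\binom{K-1+n}{n}(\sin\pi\xi)^{2n},\qquad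 |m_1(\xi)|^2=|m_0(\xi+1/2)|^2, \] and such that for every $\xi\in\mathbb R$ the partial products of $\prod_{j=0}^\infty m_0(2^{-j}\xi)$ converge. Then there are $\phi\in L^2(\mathbb R)$ and $\psi\in L^2(\mathbb R^3)$ with \[ \hat\phi(\xi)=\prod_{j=0}^\infty m_0(2^{-j}\xi),\qquad \hat\psi(\xi_1,\xi_2,\xi_3)=m_1(4\xi_1)\,\hat\phi(\xi_1)\,\hat\phi(2\xi_2)\,\hat\phi(2\xi_3) \] almost everywhere, and there is a constant $\hat c_1>0$ such that for all $c=(c_1,c_2)$ with $0<c_2\le c_1\le\hat c_1$ the system $\Psi(\psi)$ forms a frame for $\check L^2(\mathcal P)$; that is, there are $0<A\le B<\infty$ with \[ A\|f\|^2\le\sum_{j,k,m}|\langle f,\psi_{j,k,m}\rangle|^2\le B\|f\|^2\qquad\text{for all }f\in\check L^2(\mathcal P). \] Moreover $R(c)<L_{\mathit{inf}}\le L_{\mathit{sup}}<\infty$, and the optimal (largest lower and smallest upper) frame bounds $A$ and $B$ satisfy \[ \frac{1}{|\det M_c|}\bigl[L_{\mathit{inf}}-R(c)\bigr]\le A\le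 B\le\frac{1}{|\det M_c|}\bigl[L_{\mathit{sup}}+R(c)\bigr]. \] -/

import Mathlib

open MeasureTheory Filter Topology
open scoped ENNReal FourierTransform

namespace Shearlet

noncomputable section

/-- Euclidean space `ℝ³`; the coordinates `ξ₁, ξ₂, ξ₃` are `ξ 0, ξ 1, ξ 2`. -/
abbrev E3 : Type := EuclideanSpace ℝ (Fin 3)

/-- The Hilbert space `L²(ℝ³)` of complex valued functions. -/
abbrev L2R3 : Type := Lp (α := E3) ℂ 2 volume

/-- The Hilbert space `L²(ℝ)` of complex valued functions. -/
abbrev L2R : Type := Lp (α := ℝ) ℂ 2 volume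

/-! ### Frames -/

section Frames

variable {ι H : Type*} [NormedAddCommGroup H] [InnerProductSpace ℂ H]

/-- `∑ᵢ |⟨f, vᵢ⟩|²`, with values in `[0, ∞]`. -/
def frameSum (v : ι → H) (f : H) : ℝ≥0∞ := ∑' i, ‖inner ℂ (v i) f‖ₑ ^ 2

/-- `A ‖f‖² ≤ ∑ᵢ |⟨f, vᵢ⟩|²` for all `f` in the subspace `W`. -/
def IsLowerFrameBound (W : Submodule ℂ H) (v : ι → H) (A : ℝ) : Prop :=
  ∀ f ∈ W, ENNReal.ofReal (A * ‖f‖ ^ 2) ≤ frameSum v f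

/-- `∑ᵢ |⟨f, vᵢ⟩|² ≤ B ‖f‖²` for all `f` in the subspace `W`. -/
def IsUpperFrameBound (W : Submodule ℂ H) (v : ι → H) (B : ℝ) : Prop :=
  ∀ f ∈ W, frameSum v f ≤ ENNReal.ofReal (B * ‖f‖ ^ 2)

/-- The family `v` is a frame for the subspace `W`: the two frame inequalities hold on `W` with
some `0 < A ≤ B < ∞`. The vectors `vᵢ` are not required to lie in `W`. -/
def IsFrameFor (W : Submodule ℂ H) (v : ι → H) : Prop :=
  ∃ A B : ℝ, 0 < A ∧ A ≤ B ∧ IsLowerFrameBound W v A ∧ IsUpperFrameBound W v B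

end Frames

/-! ### Scaling, shear and sampling matrices -/

/-- The scaling matrix `A_{2^j} = diag(2^{jα/2}, 2^{j/2}, 2^{j/2})`, `j ∈ ℤ`. -/
def scalingMatrix (α : ℝ) (j : ℤ) : Matrix (Fin 3) (Fin 3) ℝ :=
  Matrix.diagonal ![(2 : ℝ) ^ ((j : ℝ) * α / 2), (2 : ℝ) ^ ((j : ℝ) / 2), (2 : ℝ) ^ ((j : ℝ) / 2)]

/-- The shear matrix `S_k`, `k = (k₁, k₂) ∈ ℤ²`. -/
def shearMatrix (k : ℤ × ℤ) : Matrix (Fin 3) (Fin 3) ℝ :=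
  !![1, (k.1 : ℝ), (k.2 : ℝ);
     0, 1, 0;
     0, 0, 1]

/-- The sampling matrix `M_c = diag(c₁, c₂, c₂)`. -/
def samplingMatrix (c₁ c₂ : ℝ) : Matrix (Fin 3) (Fin 3) ℝ :=
  Matrix.diagonal ![c₁, c₂, c₂]

/-- The action of a `3 × 3` matrix on `ℝ³`. -/
abbrev act (M : Matrix (Fin 3) (Fin 3) ℝ) (x : E3) : E3 := Matrix.toEuclideanLin M x

/-- An integer vector regarded as a point of `ℝ³`. -/
def intVec (n : Fin 3 → ℤ) : E3 := WithLp.toLp 2 (fun i => (n i : ℝ))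

theorem det_shear_mul_scaling_ne_zero (α : ℝ) (j : ℤ) (k : ℤ × ℤ) :
    (shearMatrix k * scalingMatrix α j).det ≠ 0 := by
  rw [Matrix.det_mul]
  refine mul_ne_zero ?_ ?_
  · simp [shearMatrix, Matrix.det_fin_three]
  · have h1 : (2 : ℝ) ^ ((j : ℝ) * α / 2) ≠ 0 := (Real.rpow_pos_of_pos two_pos _).ne'
    have h2 : (2 : ℝ) ^ ((j : ℝ) / 2) ≠ 0 := (Real.rpow_pos_of_pos two_pos _).ne'
    simp [scalingMatrix, Matrix.det_diagonal, Fin.prod_univ_three, h1, h2]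

/-! ### The shearlet system -/

/-- The index set `{(j, k) : j ≥ 0, |k₁|, |k₂| ≤ ⌈2^{j(α-1)/2}⌉}`. -/
abbrev ScaleShear (α : ℝ) : Type :=
  {p : ℕ × ℤ × ℤ // |p.2.1| ≤ ⌈(2 : ℝ) ^ ((p.1 : ℝ) * (α - 1) / 2)⌉ ∧
    |p.2.2| ≤ ⌈(2 : ℝ) ^ ((p.1 : ℝ) * (α - 1) / 2)⌉}

/-- The function `x ↦ 2^{j(α+2)/4} ψ(S_k A_{2^j} x - m)`. -/
def shearletFun (α : ℝ) (ψ : E3 → ℂ) (j : ℕ) (k : ℤ × ℤ) (m : E3) : E3 → ℂ := fun x =>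
  (((2 : ℝ) ^ ((j : ℝ) * (α + 2) / 4) : ℝ) : ℂ) *
    ψ (act (shearMatrix k * scalingMatrix α j) x - m)

theorem memLp_shearletFun (α : ℝ) {ψ : E3 → ℂ} (hψ : MemLp ψ 2 volume) (j : ℕ) (k : ℤ × ℤ)
    (m : E3) : MemLp (shearletFun α ψ j k m) 2 volume := by
  refine MemLp.const_mul ?_ _
  have hdet : LinearMap.det (Matrix.toEuclideanLin (shearMatrix k * scalingMatrix α j)) ≠ 0 := by
    rw [Matrix.toEuclideanLin_eq_toLin, LinearMap.det_toLin]
    exact det_shear_mul_scaling_ne_zero α j k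
  have h1 : MemLp (fun y : E3 => ψ (y - m)) 2 volume :=
    hψ.comp_measurePreserving (measurePreserving_sub_right volume m)
  have h2 : MemLp (fun y : E3 => ψ (y - m)) 2 (Measure.map
      (Matrix.toEuclideanLin (shearMatrix k * scalingMatrix α j)) volume) := by
    rw [Measure.map_linearMap_addHaar_eq_smul_addHaar volume hdet]
    exact h1.smul_measure ENNReal.ofReal_ne_top
  exact h2.comp_of_map (LinearMap.continuous_of_finiteDimensional _).aemeasurable

/-- The shearlet system `Ψ(ψ; c, α)`: the family of the
`ψ_{j,k,m} = 2^{j(α+2)/4} ψ(S_k A_{2^j} · - m)` with `j ≥ 0`, `|k| ≤ ⌈2^{j(α-1)/2}⌉` and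
`m = M_c n ∈ M_c ℤ³`, indexed by `((j, k), n)`. -/
def shearletSystem (α c₁ c₂ : ℝ) (ψ : L2R3) (i : ScaleShear α × (Fin 3 → ℤ)) : L2R3 :=
  (memLp_shearletFun α (Lp.memLp ψ) i.1.1.1 i.1.1.2
    (act (samplingMatrix c₁ c₂) (intVec i.2))).toLp _

/-! ### The pyramid pair and its function space -/

/-- The pyramid `𝒫₁`. -/
def pyramid₁ : Set E3 := {ξ | 1 ≤ ξ 0 ∧ |ξ 1 / ξ 0| ≤ 1 ∧ |ξ 2 / ξ 0| ≤ 1}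

/-- The pyramid `𝒫₄`. -/
def pyramid₄ : Set E3 := {ξ | ξ 0 ≤ -1 ∧ |ξ 1 / ξ 0| ≤ 1 ∧ |ξ 2 / ξ 0| ≤ 1}

/-- The pyramid pair `𝒫 = 𝒫₁ ∪ 𝒫₄`. -/
def pyramid : Set E3 := pyramid₁ ∪ pyramid₄

/-- The space `{f ∈ L²(ℝ³) : supp f̂ ⊂ 𝒫}`, where `f̂` is the `L²` Fourier transform. -/
def pyramidSpace : Submodule ℂ L2R3 where
  carrier := {f | ∀ᵐ ξ ∂(volume : Measure E3), ξ ∉ pyramid → (𝓕 f : L2R3) ξ = 0}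
  zero_mem' := by
    have h : (𝓕 (0 : L2R3) : L2R3) = 0 := (Lp.fourierTransformₗᵢ E3 ℂ).map_zero
    simp only [Set.mem_ofPred_eq, h]
    filter_upwards [Lp.coeFn_zero ℂ 2 (volume : Measure E3)] with ξ hξ _
    simp
  add_mem' := by
    intro f g hf hg
    have h : (𝓕 (f + g) : L2R3) = 𝓕 f + 𝓕 g := (Lp.fourierTransformₗᵢ E3 ℂ).map_add f g
    simp only [Set.mem_ofPred_eq] at hf hg ⊢
    rw [h]
    filter_upwards [hf, hg, Lp.coeFn_add (𝓕 f : L2R3) (𝓕 g)] with ξ h1 h2 h3 hξ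
    rw [h3, Pi.add_apply, h1 hξ, h2 hξ, add_zero]
  smul_mem' := by
    intro a f hf
    have h : (𝓕 (a • f) : L2R3) = a • 𝓕 f := (Lp.fourierTransformₗᵢ E3 ℂ).map_smul a f
    simp only [Set.mem_ofPred_eq] at hf ⊢
    rw [h]
    filter_upwards [hf, Lp.coeFn_smul a (𝓕 f : L2R3)] with ξ h1 h2 hξ
    rw [h2, Pi.smul_apply, h1 hξ, smul_zero]

/-! ### The covering quantities

All of them take values in `[0, ∞]`, and none depends on the representative of `𝓕 ψ`. -/

/-- `Φ(ξ, ω) = ∑_{j ≥ 0} ∑_{|k| ≤ ⌈2^{j(α-1)/2}⌉}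
|ψ̂(S_{-k}ᵀ A_{2^{-j}} ξ)| |ψ̂(S_{-k}ᵀ A_{2^{-j}} ξ + ω)|`. -/
def overlap (α : ℝ) (ψ : L2R3) (ξ ω : E3) : ℝ≥0∞ :=
  ∑' p : ScaleShear α,
    ‖(𝓕 ψ : L2R3) (act ((shearMatrix (-p.1.2)).transpose *
        scalingMatrix α (-(p.1.1 : ℤ))) ξ)‖ₑ *
      ‖(𝓕 ψ : L2R3) (act ((shearMatrix (-p.1.2)).transpose *
        scalingMatrix α (-(p.1.1 : ℤ))) ξ + ω)‖ₑ

/-- `Γ(ω)`, the essential supremum of `Φ(ξ, ω)` over `ξ ∈ 𝒫`. -/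
def maxOverlap (α : ℝ) (ψ : L2R3) (ω : E3) : ℝ≥0∞ :=
  essSup (fun ξ => overlap α ψ ξ ω) (volume.restrict pyramid)

/-- `L_inf`, the essential infimum of `Φ(ξ, 0)` over `ξ ∈ 𝒫`. -/
def Linf (α : ℝ) (ψ : L2R3) : ℝ≥0∞ :=
  essInf (fun ξ => overlap α ψ ξ 0) (volume.restrict pyramid)

/-- `L_sup`, the essential supremum of `Φ(ξ, 0)` over `ξ ∈ 𝒫`. -/
def Lsup (α : ℝ) (ψ : L2R3) : ℝ≥0∞ :=
  essSup (fun ξ => overlap α ψ ξ 0) (volume.restrict pyramid)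

/-- `R(c) = ∑_{m ∈ ℤ³ ∖ {0}} (Γ(M_c⁻¹ m) Γ(-M_c⁻¹ m))^{1/2}`. -/
def Rsum (α c₁ c₂ : ℝ) (ψ : L2R3) : ℝ≥0∞ :=
  ∑' m : {m : Fin 3 → ℤ // m ≠ 0},
    (maxOverlap α ψ (act (samplingMatrix c₁ c₂)⁻¹ (intVec m)) *
      maxOverlap α ψ (-act (samplingMatrix c₁ c₂)⁻¹ (intVec m))) ^ (1 / 2 : ℝ)

/-! ### The generator -/

/-- `m₀` is a low pass filter of order `(K, L)`:
`|m₀(ξ)|² = cos(πξ)^{2K} ∑_{n=0}^{L-1} binom(K-1+n, n) sin(πξ)^{2n}`. -/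
def IsLowPassFilter (K L : ℕ) (m₀ : ℝ → ℂ) : Prop :=
  ∀ ξ : ℝ, ‖m₀ ξ‖ ^ 2 = Real.cos (Real.pi * ξ) ^ (2 * K) *
    ∑ n ∈ Finset.range L, ((K - 1 + n).choose n : ℝ) * Real.sin (Real.pi * ξ) ^ (2 * n)

/-- `m₁` is a bandpass filter associated with `m₀`: `|m₁(ξ)|² = |m₀(ξ + 1/2)|²`. -/
def IsBandPassFilter (m₀ m₁ : ℝ → ℂ) : Prop :=
  ∀ ξ : ℝ, ‖m₁ ξ‖ ^ 2 = ‖m₀ (ξ + 1 / 2)‖ ^ 2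

/-- `φhat(ξ) = ∏_{j=0}^∞ m₀(2^{-j} ξ)`, as the limit of the partial products, for every `ξ`. -/
def IsInfiniteProduct (m₀ φhat : ℝ → ℂ) : Prop :=
  ∀ ξ : ℝ, Tendsto (fun N : ℕ => ∏ j ∈ Finset.range N, m₀ (ξ / 2 ^ j)) atTop (𝓝 (φhat ξ))

/-- `ξ ↦ m₁(4ξ₁) φhat(ξ₁) φhat(2ξ₂) φhat(2ξ₃)`. -/
def generatorFT (m₁ φhat : ℝ → ℂ) (ξ : E3) : ℂ :=
  m₁ (4 * ξ 0) * φhat (ξ 0) * φhat (2 * ξ 1) * φhat (2 * ξ 2)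

end

end Shearlet

namespace Shearlet

noncomputable section

/-! ### Filters and the refinable function -/

/-! On the Fourier side, the coefficients at a fixed scale and shear are, up to a constant and a
linear change of variables, the integer-frequency Fourier coefficients of a product of `f̂` with a
dilated `ψ̂`. By Parseval their ℓ² norm is the L² norm of the periodized product over the unit cube.
Expanding the squared periodization separates a diagonal term `∫ |f̂|² |ψ̂(B ·)|²` from correlations
with nonzero lattice shifts (`tsum_sq_inner_bounds`). Summed over scales and shears, the diagonal
becomes `∫ |f̂|² Φ(·, 0)`, which lies between `L_inf ‖f‖²` and `L_sup ‖f‖²` because `f̂` lives on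
the pyramid. A weighted Cauchy–Schwarz inequality bounds the correlations by `R(c) ‖f‖²`
(`tsum_correlation_le`, `frameSum_bounds`). Hence `R(c) < L_inf` and `L_sup < ∞` give the frame
property with the stated bounds (`isFrameFor_and_optimal_bounds`).

Both conditions follow from pointwise estimates of `ψ̂`. The filter is compared with powers of a
cosine, and Viète's product for the cosines then gives cubic decay of `φhat` as well as a lower
bound near the origin, while `m₁(4 ·)` vanishes to order `K` at the origin. In the overlap sum this
zero absorbs the many shears that count at low frequency, and the decay controls the remaining
directions. Thus `Γ(ω)` is at most a constant times `∏ᵢ (1 + |ωᵢ|)⁻²` (`overlapSum_le`), which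
yields `L_sup < ∞` and `R(c) = O(c₁²)` (`Rsum_le`). Conversely, `ψ̂` is bounded below on a small
truncated cone, and every point of the pyramid is carried there by some admissible scale and shear
(`le_overlapSum`). So `L_inf` has a positive lower bound independent of `c`, and small `c₁`
suffices. -/

theorem one_sub_pow_mul_sum_choose_le_one {K : ℕ} (hK : 1 ≤ K) (L : ℕ) {y : ℝ} (hy0 : 0 ≤ y)
    (hy1 : y ≤ 1) :
    (1 - y) ^ K * ∑ n ∈ Finset.range L, ((K - 1 + n).choose n : ℝ) * y ^ n ≤ 1 := by
  obtain ⟨k, rfl⟩ : ∃ k, K = k + 1 := ⟨K - 1, by omega⟩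
  rcases hy1.lt_or_eq with h | rfl
  -- The sum is a partial sum, with nonnegative terms, of the negative binomial series of `(1 -
  -- y)⁻ᴷ`.
  · have hn : ‖y‖ < 1 := by rwa [Real.norm_of_nonneg hy0]
    have hs := summable_choose_mul_geometric_of_norm_lt_one k hn
    have ht := tsum_choose_mul_geometric_of_norm_lt_one k hn
    have hle : ∑ n ∈ Finset.range L, ((k + 1 - 1 + n).choose n : ℝ) * y ^ n ≤
        1 / (1 - y) ^ (k + 1) := by
      rw [← ht]
      refine le_trans (le_of_eq ?_) (hs.sum_le_tsum (Finset.range L) fun n _ => by positivity)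
      refine Finset.sum_congr rfl fun n _ => ?_
      rw [Nat.add_sub_cancel, add_comm k n, Nat.choose_symm_add]
    have hp : 0 < (1 - y) ^ (k + 1) := pow_pos (by linarith) _
    calc _ ≤ (1 - y) ^ (k + 1) * (1 / (1 - y) ^ (k + 1)) := by gcongr
      _ = 1 := by field_simp
  · simp

/-- Test the negative binomial bound at `y = 2/5`, the maximizer of `(1 - y)³ y²`, hence the best
point when `L` is about `2K/3`. Cubing turns `(2/5)^L` into a power governed by `3L ≤ 2K`. The
factor `64 = 4³` is what later produces decay of order three. -/
theorem sum_choose_le {K L : ℕ} (hK : 15 ≤ K) (hL : 1 ≤ L) (hKL : 3 * L ≤ 2 * K) :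
    64 * ∑ n ∈ Finset.range L, ((K - 1 + n).choose n : ℝ) ≤ 4 ^ K := by
  set P := ∑ n ∈ Finset.range L, ((K - 1 + n).choose n : ℝ)
  have hP0 : 0 ≤ P := Finset.sum_nonneg fun n _ => by positivity
  have h1 : P * ((2 / 5 : ℝ) ^ (L - 1)) ≤
      ∑ n ∈ Finset.range L, ((K - 1 + n).choose n : ℝ) * (2 / 5 : ℝ) ^ n := by
    rw [Finset.sum_mul]
    refine Finset.sum_le_sum fun n hn => ?_
    have : n ≤ L - 1 := by have := Finset.mem_range.1 hn; omega
    exact mul_le_mul_of_nonneg_left (pow_le_pow_of_le_one (by norm_num) (by norm_num) this)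
      (by positivity)
  have h2 := one_sub_pow_mul_sum_choose_le_one (K := K) (by omega) L (y := 2 / 5) (by norm_num)
    (by norm_num)
  have h3 : (3 / 5 : ℝ) ^ K * (P * (2 / 5 : ℝ) ^ (L - 1)) ≤ 1 := by
    refine le_trans ?_ h2
    norm_num only
    gcongr
  have h3' : (3 / 5 : ℝ) ^ K * (P * (2 / 5 : ℝ) ^ L) ≤ 2 / 5 := by
    have : (2 / 5 : ℝ) ^ L = (2 / 5 : ℝ) ^ (L - 1) * (2 / 5) := by
      rw [← pow_succ]; congr 1; omega
    rw [this]; nlinarith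
  have h4 : (27 / 125 : ℝ) ^ K * (P ^ 3 * (4 / 25 : ℝ) ^ K) ≤ 8 / 125 := by
    have h5 : ((3 / 5 : ℝ) ^ K * (P * (2 / 5 : ℝ) ^ L)) ^ 3 ≤ (2 / 5) ^ 3 := by gcongr
    refine le_trans ?_ (h5.trans (by norm_num))
    have e1 : (27 / 125 : ℝ) ^ K = ((3 / 5 : ℝ) ^ K) ^ 3 := by
      rw [← pow_mul, mul_comm, pow_mul]; norm_num
    have e2 : (4 / 25 : ℝ) ^ K ≤ ((2 / 5 : ℝ) ^ L) ^ 3 := by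
      have : (4 / 25 : ℝ) ^ K = (2 / 5 : ℝ) ^ (2 * K) := by rw [pow_mul]; norm_num
      rw [this, ← pow_mul]
      exact pow_le_pow_of_le_one (by norm_num) (by norm_num) (by omega)
    rw [mul_pow, mul_pow, e1]
    gcongr
  -- The base is `4³ · (27/125) · (4/25)`; as it exceeds one, `K = 15` is the worst case.
  have h6 : (64 ^ 3 * (8 / 125) : ℝ) ≤ (6912 / 3125 : ℝ) ^ K :=
    le_trans (by norm_num) (pow_le_pow_right₀ (by norm_num) hK)
  have h7 : (64 * P) ^ 3 ≤ ((4 : ℝ) ^ K) ^ 3 := by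
    have e : ((4 : ℝ) ^ K) ^ 3 = (6912 / 3125 : ℝ) ^ K * ((27 / 125 : ℝ) ^ K * (4 / 25) ^ K)⁻¹ := by
      rw [← mul_pow, ← inv_pow, ← mul_pow, ← pow_mul, mul_comm K, pow_mul]; norm_num
    rw [e, le_mul_inv_iff₀ (by positivity)]
    nlinarith
  exact le_of_pow_le_pow_left₀ (by norm_num) (by positivity) h7

/-- Viète's identity, by iterating the double-angle formula. -/
theorem prod_cos_mul_sin (x : ℝ) (N : ℕ) :
    (∏ j ∈ Finset.range N, Real.cos (x / 2 ^ j)) * (2 ^ N * Real.sin (2 * x / 2 ^ N)) =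
      Real.sin (2 * x) := by
  induction N with
  | zero => simp
  | succ N ih =>
    rw [← ih, Finset.prod_range_succ]
    have h1 : 2 * x / 2 ^ (N + 1) = x / 2 ^ N := by rw [pow_succ]; field_simp
    have h2 : 2 * x / 2 ^ N = 2 * (x / 2 ^ N) := by ring
    rw [h1, h2, Real.sin_two_mul]; ring

section LowPass

variable {K L : ℕ} {m₀ m₁ φhat : ℝ → ℂ}

theorem IsLowPassFilter.norm_sq_le (hm₀ : IsLowPassFilter K L m₀) (ξ : ℝ) {Q : ℝ}
    (hQ : ∑ n ∈ Finset.range L, ((K - 1 + n).choose n : ℝ) ≤ Q) :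
    ‖m₀ ξ‖ ^ 2 ≤ Real.cos (Real.pi * ξ) ^ (2 * K) * Q := by
  rw [hm₀ ξ]
  refine mul_le_mul_of_nonneg_left (le_trans (Finset.sum_le_sum fun n _ => ?_) hQ)
    (by rw [pow_mul]; positivity)
  refine mul_le_of_le_one_right (by positivity) ?_
  rw [pow_mul]
  exact pow_le_one₀ (sq_nonneg _) (Real.sin_sq_le_one _)

theorem IsLowPassFilter.norm_le_one (hm₀ : IsLowPassFilter K L m₀) (hK : 1 ≤ K) (ξ : ℝ) :
    ‖m₀ ξ‖ ≤ 1 := by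
  have h := one_sub_pow_mul_sum_choose_le_one hK L (sq_nonneg (Real.sin (Real.pi * ξ)))
    (Real.sin_sq_le_one _)
  have h2 : ‖m₀ ξ‖ ^ 2 ≤ 1 := by
    rw [hm₀ ξ]
    simpa only [← Real.cos_sq', ← pow_mul] using h
  exact (sq_le_one_iff₀ (norm_nonneg _)).1 h2

theorem IsLowPassFilter.le_norm (hm₀ : IsLowPassFilter K L m₀) (hL : 1 ≤ L) (ξ : ℝ) :
    |Real.cos (Real.pi * ξ)| ^ K ≤ ‖m₀ ξ‖ := by
  refine le_of_pow_le_pow_left₀ two_ne_zero (norm_nonneg _) ?_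
  have h1 : (1 : ℝ) ≤ ∑ n ∈ Finset.range L,
      ((K - 1 + n).choose n : ℝ) * Real.sin (Real.pi * ξ) ^ (2 * n) := by
    refine le_trans (by simp) (Finset.single_le_sum (f := fun n =>
      ((K - 1 + n).choose n : ℝ) * Real.sin (Real.pi * ξ) ^ (2 * n)) (fun n _ => ?_)
      (Finset.mem_range.2 (show 0 < L by omega)))
    rw [pow_mul]; positivity
  rw [hm₀ ξ, ← pow_mul, mul_comm K 2, pow_mul, sq_abs, ← pow_mul]
  exact le_mul_of_one_le_right (by rw [pow_mul]; positivity) h1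

theorem IsBandPassFilter.norm_eq (hm₁ : IsBandPassFilter m₀ m₁) (ξ : ℝ) :
    ‖m₁ ξ‖ = ‖m₀ (ξ + 1 / 2)‖ := by
  have h := hm₁ ξ
  rwa [sq_eq_sq₀ (norm_nonneg _) (norm_nonneg _)] at h

theorem abs_sin_abs (x : ℝ) : |Real.sin (|x|)| = |Real.sin x| := by
  rcases abs_choice x with h | h <;> simp [h]

theorem cos_pi_mul_add_half (ξ : ℝ) :
    Real.cos (Real.pi * (ξ + 1 / 2)) = -Real.sin (Real.pi * ξ) := by
  rw [mul_add, mul_one_div, Real.cos_add_pi_div_two]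

/-- The half-period shift turns the cosine factor of the filter into a sine, so `m₁` has a zero of
order `K` at the origin. The constant `32` is `16`, from `4π ≤ 16`, times `2`, from the binomial sum
being at most `4ᴷ`. -/
theorem IsBandPassFilter.norm_le (hm₁ : IsBandPassFilter m₀ m₁) (hm₀ : IsLowPassFilter K L m₀)
    (hQ : 64 * ∑ n ∈ Finset.range L, ((K - 1 + n).choose n : ℝ) ≤ 4 ^ K) (hK : 1 ≤ K) (x : ℝ) :
    ‖m₁ (4 * x)‖ ≤ 32 ^ K * min 1 |x| ^ K := by
  rcases le_total 1 |x| with h | h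
  · rw [min_eq_left h, hm₁.norm_eq, one_pow, mul_one]
    exact (hm₀.norm_le_one hK _).trans (one_le_pow₀ (by norm_num))
  · rw [min_eq_right h, hm₁.norm_eq, ← mul_pow]
    refine le_of_pow_le_pow_left₀ two_ne_zero (by positivity) ?_
    refine (hm₀.norm_sq_le (Q := 4 ^ K) _ ?_).trans ?_
    · have : (0 : ℝ) ≤ ∑ n ∈ Finset.range L, ((K - 1 + n).choose n : ℝ) :=
        Finset.sum_nonneg fun n _ => by positivity
      linarith
    · rw [cos_pi_mul_add_half, pow_mul, neg_sq, ← pow_mul _ K 2, mul_comm K 2,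
        pow_mul _ 2 K, ← mul_pow]
      refine pow_le_pow_left₀ (by positivity) ?_ K
      have h1 : |Real.sin (Real.pi * (4 * x))| ≤ 16 * |x| := by
        refine Real.abs_sin_le_abs.trans ?_
        rw [abs_mul, abs_mul, abs_of_pos Real.pi_pos, abs_of_pos (by norm_num : (0 : ℝ) < 4)]
        nlinarith [Real.pi_le_four, abs_nonneg x]
      have h2 := pow_le_pow_left₀ (abs_nonneg _) h1 2
      rw [sq_abs] at h2
      nlinarith

/-- With `n + 3` factors, the sine on the left of Viète's identity has its argument in `[π/4, π/2]`
up to sign, where Jordan's inequality bounds it below by `1/2`. -/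
theorem abs_prod_cos_le {ξ : ℝ} {n : ℕ} (h1 : 2 ^ n ≤ |ξ|) (h2 : |ξ| < 2 ^ (n + 1)) :
    |∏ j ∈ Finset.range (n + 3), Real.cos (Real.pi * (ξ / 2 ^ j))| ≤ 2 / 2 ^ (n + 3) := by
  have h := congrArg abs (prod_cos_mul_sin (Real.pi * ξ) (n + 3))
  simp only [mul_div_assoc] at h
  rw [abs_mul, abs_mul, abs_of_pos (by positivity : (0 : ℝ) < 2 ^ (n + 3))] at h
  have hs : 1 / 2 ≤ |Real.sin (2 * (Real.pi * (ξ / 2 ^ (n + 3))))| := by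
    rw [← abs_sin_abs]
    have e : |2 * (Real.pi * (ξ / 2 ^ (n + 3)))| = Real.pi / 4 * (|ξ| / 2 ^ n) := by
      rw [abs_mul, abs_mul, abs_div, abs_of_pos Real.pi_pos, abs_two, abs_of_pos
        (by positivity : (0 : ℝ) < 2 ^ (n + 3)), pow_add]
      field_simp; norm_num; ring
    have l1 : 1 ≤ |ξ| / 2 ^ n := by rwa [one_le_div (by positivity)]
    have l2 : |ξ| / 2 ^ n ≤ 2 := by
      rw [div_le_iff₀ (by positivity)]; rw [pow_succ] at h2; linarith
    rw [e]
    refine le_trans ?_ ((Real.mul_le_sin (by positivity)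
      (by nlinarith [Real.pi_pos])).trans (le_abs_self _))
    have : 2 / Real.pi * (Real.pi / 4 * (|ξ| / 2 ^ n)) = |ξ| / 2 ^ n / 2 := by
      field_simp; norm_num
    rw [this]; linarith
  have hle := Real.abs_sin_le_one (2 * (Real.pi * ξ))
  rw [← h] at hle
  rw [le_div_iff₀ (by positivity)]
  have h0 := mul_nonneg (abs_nonneg (∏ j ∈ Finset.range (n + 3), Real.cos (Real.pi * (ξ / 2 ^ j))))
    (by positivity : (0 : ℝ) ≤ 2 ^ (n + 3))
  nlinarith

/-- In Viète's identity Jordan's inequality gives `4|ξ|` below for `|sin 2πξ|`, and `|sin t| ≤ |t|`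
with `π ≤ 4` gives `8|ξ|` above for the other sine factor, uniformly in `N`. -/
theorem half_le_abs_prod_cos {ξ : ℝ} (h : |ξ| ≤ 1 / 4) (N : ℕ) :
    1 / 2 ≤ |∏ j ∈ Finset.range N, Real.cos (Real.pi * (ξ / 2 ^ j))| := by
  rcases eq_or_ne ξ 0 with rfl | h0
  · simp; norm_num
  have hx : 0 < |ξ| := abs_pos.2 h0
  have e := congrArg abs (prod_cos_mul_sin (Real.pi * ξ) N)
  simp only [mul_div_assoc] at e
  rw [abs_mul, abs_mul, abs_of_pos (by positivity : (0 : ℝ) < 2 ^ N)] at e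
  have h1 : 2 ^ N * |Real.sin (2 * (Real.pi * (ξ / 2 ^ N)))| ≤ 8 * |ξ| := by
    refine (mul_le_mul_of_nonneg_left Real.abs_sin_le_abs (by positivity)).trans ?_
    rw [abs_mul, abs_mul, abs_div, abs_of_pos Real.pi_pos, abs_two, abs_of_pos
      (by positivity : (0 : ℝ) < 2 ^ N)]
    have : 2 ^ N * (2 * (Real.pi * (|ξ| / 2 ^ N))) = 2 * Real.pi * |ξ| := by field_simp
    rw [this]
    nlinarith [Real.pi_le_four]
  have h2 : 4 * |ξ| ≤ |Real.sin (2 * (Real.pi * ξ))| := by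
    rw [← abs_sin_abs, abs_mul, abs_mul, abs_of_pos Real.pi_pos, abs_two]
    refine le_trans ?_ ((Real.mul_le_sin (by positivity)
      (by nlinarith [Real.pi_pos])).trans (le_abs_self _))
    apply le_of_eq; field_simp; norm_num
  rw [← e] at h2
  have h3 := mul_le_mul_of_nonneg_left h1
    (abs_nonneg (∏ j ∈ Finset.range N, Real.cos (Real.pi * (ξ / 2 ^ j))))
  by_contra! hc
  nlinarith

theorem IsInfiniteProduct.measurable (hφ : IsInfiniteProduct m₀ φhat) (hm : Measurable m₀) :
    Measurable φhat :=
  measurable_of_tendsto_metrizable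
    (f := fun (N : ℕ) ξ => ∏ j ∈ Finset.range N, m₀ (ξ / 2 ^ j))
    (fun N => by fun_prop) (tendsto_pi_nhds.2 hφ)

theorem IsInfiniteProduct.tendsto_norm (hφ : IsInfiniteProduct m₀ φhat) (ξ : ℝ) :
    Tendsto (fun N : ℕ => ∏ j ∈ Finset.range N, ‖m₀ (ξ / 2 ^ j)‖) atTop (𝓝 ‖φhat ξ‖) := by
  simpa only [norm_prod] using (hφ ξ).norm

theorem IsInfiniteProduct.norm_le_prod (hφ : IsInfiniteProduct m₀ φhat) (h1 : ∀ ξ, ‖m₀ ξ‖ ≤ 1)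
    (ξ : ℝ) (N : ℕ) : ‖φhat ξ‖ ≤ ∏ j ∈ Finset.range N, ‖m₀ (ξ / 2 ^ j)‖ := by
  have ha : Antitone fun N : ℕ => ∏ j ∈ Finset.range N, ‖m₀ (ξ / 2 ^ j)‖ := by
    refine antitone_nat_of_succ_le fun N => ?_
    rw [Finset.prod_range_succ]
    exact mul_le_of_le_one_right (Finset.prod_nonneg fun _ _ => norm_nonneg _) (h1 _)
  exact ha.le_of_tendsto (hφ.tendsto_norm ξ) N

theorem IsInfiniteProduct.norm_le_one (hφ : IsInfiniteProduct m₀ φhat) (h1 : ∀ ξ, ‖m₀ ξ‖ ≤ 1)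
    (ξ : ℝ) : ‖φhat ξ‖ ≤ 1 := by
  simpa using hφ.norm_le_prod h1 ξ 0

/-- For `2ⁿ ≤ |ξ| < 2ⁿ⁺¹`, truncate at `N = n + 3` factors. Each is at most `|cos|ᴷ · 2ᴷ/8`, and the
cosines multiply to at most `2/2ᴺ`. The powers `2^{KN}` cancel, leaving `2ᴷ/8ᴺ`, where `2ᴺ ≥ 1 +
|ξ|`. -/
theorem IsInfiniteProduct.norm_le (hφ : IsInfiniteProduct m₀ φhat)
    (hm₀ : IsLowPassFilter K L m₀)
    (hQ : 64 * ∑ n ∈ Finset.range L, ((K - 1 + n).choose n : ℝ) ≤ 4 ^ K) (hK : 3 ≤ K) (ξ : ℝ) :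
    ‖φhat ξ‖ ≤ 2 ^ K * (1 + |ξ|)⁻¹ ^ 3 := by
  have h1 := hm₀.norm_le_one (by omega)
  rw [inv_pow, ← div_eq_mul_inv, le_div_iff₀ (by positivity)]
  rcases le_total |ξ| 1 with h | h
  · have h2 : (1 + |ξ|) ^ 3 ≤ 2 ^ 3 := pow_le_pow_left₀ (by positivity) (by linarith) 3
    have h3 : (2 : ℝ) ^ 3 ≤ 2 ^ K := pow_le_pow_right₀ (by norm_num) hK
    exact (mul_le_of_le_one_left (by positivity) (hφ.norm_le_one h1 ξ)).trans (h2.trans h3)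
  · obtain ⟨n, hn1, hn2⟩ := exists_nat_pow_near h (by norm_num : (1 : ℝ) < 2)
    set N := n + 3 with hN
    have hc := abs_prod_cos_le hn1 hn2
    have hsq : ‖φhat ξ‖ ^ 2 ≤ (2 ^ K / 8 ^ N) ^ 2 := by
      calc ‖φhat ξ‖ ^ 2 ≤ (∏ j ∈ Finset.range N, ‖m₀ (ξ / 2 ^ j)‖) ^ 2 := by
            gcongr; exact hφ.norm_le_prod h1 ξ N
        _ = ∏ j ∈ Finset.range N, ‖m₀ (ξ / 2 ^ j)‖ ^ 2 := by rw [Finset.prod_pow]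
        _ ≤ ∏ j ∈ Finset.range N, (Real.cos (Real.pi * (ξ / 2 ^ j)) ^ (2 * K) * (4 ^ K / 64)) := by
            refine Finset.prod_le_prod (fun _ _ => by positivity) fun j _ =>
              hm₀.norm_sq_le _ (by linarith)
        _ = |∏ j ∈ Finset.range N, Real.cos (Real.pi * (ξ / 2 ^ j))| ^ (2 * K) *
              (4 ^ K / 64) ^ N := by
            rw [Finset.prod_mul_distrib, Finset.prod_pow, Finset.prod_const, Finset.card_range,
              pow_mul |_|, sq_abs, pow_mul]
        _ ≤ (2 / 2 ^ N) ^ (2 * K) * (4 ^ K / 64) ^ N := by gcongr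
        _ = (2 ^ K / 8 ^ N) ^ 2 := by
            rw [div_pow, div_pow, div_pow, div_mul_div_comm, ← pow_mul 8, mul_comm N 2, pow_mul 8,
              ← pow_mul 2 N, ← pow_mul 4 K, ← pow_mul 2 K, mul_comm K 2, pow_mul 2 2 K,
              show N * (2 * K) = 2 * (K * N) by ring, pow_mul 2 2 (K * N)]
            norm_num
            field_simp
    have hb : ‖φhat ξ‖ ≤ 2 ^ K / 8 ^ N := le_of_pow_le_pow_left₀ two_ne_zero (by positivity) hsq
    have hx : 1 + |ξ| ≤ 2 ^ N := by
      have e : (2 : ℝ) ^ N = 4 * 2 ^ (n + 1) := by rw [hN]; ring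
      have := one_le_pow₀ (n := n + 1) (by norm_num : (1 : ℝ) ≤ 2)
      linarith
    calc ‖φhat ξ‖ * (1 + |ξ|) ^ 3 ≤ 2 ^ K / 8 ^ N * (2 ^ N) ^ 3 := by gcongr
      _ = 2 ^ K := by
        rw [← pow_mul, mul_comm N 3, pow_mul]; norm_num

theorem IsInfiniteProduct.le_norm (hφ : IsInfiniteProduct m₀ φhat)
    (hm₀ : IsLowPassFilter K L m₀) (hL : 1 ≤ L) {ξ : ℝ} (hξ : |ξ| ≤ 1 / 4) :
    (1 / 2) ^ K ≤ ‖φhat ξ‖ := by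
  refine ge_of_tendsto' (hφ.tendsto_norm ξ) fun N => ?_
  calc (1 / 2 : ℝ) ^ K ≤ |∏ j ∈ Finset.range N, Real.cos (Real.pi * (ξ / 2 ^ j))| ^ K := by
        gcongr; exact half_le_abs_prod_cos hξ N
    _ = ∏ j ∈ Finset.range N, |Real.cos (Real.pi * (ξ / 2 ^ j))| ^ K := by
        rw [Finset.abs_prod, Finset.prod_pow]
    _ ≤ _ := Finset.prod_le_prod (fun _ _ => by positivity) fun j _ => hm₀.le_norm hL _

/-- Here `4π|x|` lies in `[π/3, 2π/3]`, so its sine is bounded below by Jordan's inequality, applied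
on either side of `π/2`. -/
theorem IsBandPassFilter.le_norm (hm₁ : IsBandPassFilter m₀ m₁) (hm₀ : IsLowPassFilter K L m₀)
    (hL : 1 ≤ L) {x : ℝ} (h1 : 1 / 12 ≤ |x|) (h2 : |x| ≤ 1 / 6) :
    (1 / 2) ^ K ≤ ‖m₁ (4 * x)‖ := by
  rw [hm₁.norm_eq]
  refine le_trans ?_ (hm₀.le_norm hL _)
  rw [cos_pi_mul_add_half, abs_neg]
  refine pow_le_pow_left₀ (by norm_num) ?_ K
  rw [← abs_sin_abs, abs_mul, abs_mul, abs_of_pos Real.pi_pos,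
    abs_of_pos (by norm_num : (0 : ℝ) < 4)]
  refine le_trans ?_ (le_abs_self _)
  have hp := Real.pi_pos
  rcases le_total |x| (1 / 8) with h | h
  · refine le_trans ?_ (Real.mul_le_sin (by positivity) (by nlinarith))
    have : 2 / Real.pi * (Real.pi * (4 * |x|)) = 8 * |x| := by field_simp; norm_num
    rw [this]; linarith
  · rw [← Real.sin_pi_sub]
    refine le_trans ?_ (Real.mul_le_sin (by nlinarith) (by nlinarith))
    have : 2 / Real.pi * (Real.pi - Real.pi * (4 * |x|)) = 2 - 8 * |x| := by field_simp; ring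
    rw [this]; linarith

/-- Size estimate for the Fourier transform of the generator. -/
theorem norm_generatorFT_le (hφ : IsInfiniteProduct m₀ φhat)
    (hm₀ : IsLowPassFilter K L m₀) (hm₁ : IsBandPassFilter m₀ m₁)
    (hQ : 64 * ∑ n ∈ Finset.range L, ((K - 1 + n).choose n : ℝ) ≤ 4 ^ K) (hK : 3 ≤ K) (η : E3) :
    ‖generatorFT m₁ φhat η‖ ≤ 32 ^ K * (2 ^ K) ^ 3 *
      (min 1 |η 0| ^ K * (1 + |η 0|)⁻¹ ^ 3 * (1 + |η 1|)⁻¹ ^ 3 * (1 + |η 2|)⁻¹ ^ 3) := by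
  have hb (x : ℝ) : ‖φhat (2 * x)‖ ≤ 2 ^ K * (1 + |x|)⁻¹ ^ 3 := by
    refine (hφ.norm_le hm₀ hQ hK _).trans ?_
    have : 1 + |x| ≤ 1 + |2 * x| := by rw [abs_mul, abs_two]; linarith [abs_nonneg x]
    gcongr
  rw [generatorFT, norm_mul, norm_mul, norm_mul]
  calc _ ≤ (32 ^ K * min 1 |η 0| ^ K) * (2 ^ K * (1 + |η 0|)⁻¹ ^ 3) *
        (2 ^ K * (1 + |η 1|)⁻¹ ^ 3) * (2 ^ K * (1 + |η 2|)⁻¹ ^ 3) := by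
        gcongr
        · exact hm₁.norm_le hm₀ hQ (by omega) _
        · exact hφ.norm_le hm₀ hQ hK _
        · exact hb _
        · exact hb _
    _ = _ := by ring

theorem le_norm_generatorFT (hφ : IsInfiniteProduct m₀ φhat)
    (hm₀ : IsLowPassFilter K L m₀) (hm₁ : IsBandPassFilter m₀ m₁) (hL : 1 ≤ L) {η : E3}
    (h0 : 1 / 12 ≤ |η 0|) (h0' : |η 0| ≤ 1 / 6) (h1 : |η 1| ≤ |η 0| / 2)
    (h2 : |η 2| ≤ |η 0| / 2) : ((1 / 2) ^ K) ^ 4 ≤ ‖generatorFT m₁ φhat η‖ := by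
  have hb (x : ℝ) (hx : |x| ≤ |η 0| / 2) : (1 / 2) ^ K ≤ ‖φhat (2 * x)‖ :=
    hφ.le_norm hm₀ hL (by rw [abs_mul, abs_two]; linarith)
  rw [generatorFT, norm_mul, norm_mul, norm_mul]
  calc ((1 / 2 : ℝ) ^ K) ^ 4 = (1 / 2) ^ K * (1 / 2) ^ K * (1 / 2) ^ K * (1 / 2) ^ K := by ring
    _ ≤ _ := by
      gcongr
      · exact hm₁.le_norm hm₀ hL h0 h0'
      · exact hφ.le_norm hm₀ hL (by linarith)
      · exact hb _ h1
      · exact hb _ h2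

theorem measurable_generatorFT (h1 : Measurable m₁) (hφ : Measurable φhat) :
    Measurable (generatorFT m₁ φhat) := by
  unfold generatorFT
  fun_prop

end LowPass

/-! ### Lattice sums -/

/-- `∑_{k ∈ ℤ} (1 + |k|)⁻²`. -/
def intSum : ℝ≥0∞ := ∑' k : ℤ, ENNReal.ofReal ((1 + |(k : ℝ)|)⁻¹ ^ 2)

theorem intSum_ne_top : intSum ≠ ⊤ := by
  have h : Summable fun k : ℤ => (1 + |(k : ℝ)|)⁻¹ ^ 2 := by
    have h1 : Summable fun k : ℤ => |(k : ℝ)| ^ (-2 : ℝ) :=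
      Real.summable_abs_int_rpow (by norm_num)
    have h2 : Summable fun k : ℤ => |(k : ℝ)| ^ (-2 : ℝ) + if k = 0 then (1 : ℝ) else 0 :=
      h1.add (summable_of_hasFiniteSupport (Set.Finite.subset (Set.finite_singleton (0 : ℤ))
        fun k hk => by by_contra h; simp_all))
    refine Summable.of_nonneg_of_le (fun k => by positivity) (fun k => ?_) h2
    rcases eq_or_ne k 0 with rfl | hk
    · simp
    · rw [if_neg hk, add_zero, Real.rpow_neg (abs_nonneg _), inv_pow]
      have : 0 < |(k : ℝ)| := abs_pos.2 (by exact_mod_cast hk)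
      have e : |(k : ℝ)| ^ (2 : ℝ) = |(k : ℝ)| ^ 2 := by norm_cast
      rw [e]
      gcongr
      linarith
  exact h.tsum_ofReal_ne_top

/-- Shifting by `⌊t⌋` reduces to `t ∈ [0, 1)`, where `1 + |t - k|` is at least half of `1 + |k|`. -/
theorem tsum_int_sub_le (t : ℝ) :
    ∑' k : ℤ, ENNReal.ofReal ((1 + |t - k|)⁻¹ ^ 2) ≤ 4 * intSum := by
  rw [← (Equiv.addRight ⌊t⌋).tsum_eq, intSum, ← ENNReal.tsum_mul_left]
  refine ENNReal.tsum_le_tsum fun k => ?_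
  rw [show (4 : ℝ≥0∞) = ENNReal.ofReal 4 by simp, ← ENNReal.ofReal_mul (by norm_num)]
  refine ENNReal.ofReal_le_ofReal ?_
  have h0 := Int.fract_nonneg t
  have h1 := Int.fract_lt_one t
  have e : t - ((Equiv.addRight ⌊t⌋ k : ℤ) : ℝ) = Int.fract t - k := by
    simp only [Equiv.coe_addRight, Int.cast_add, Int.fract]; ring
  rw [e]
  have h2 : (1 + |(k : ℝ)|) / 2 ≤ 1 + |Int.fract t - k| := by
    have h3 : |(k : ℝ)| ≤ |Int.fract t - k| + |Int.fract t| := by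
      have := abs_sub (Int.fract t) (Int.fract t - k)
      rw [sub_sub_cancel] at this; linarith
    rw [abs_of_nonneg h0] at h3
    linarith [abs_nonneg (Int.fract t - k)]
  calc (1 + |Int.fract t - k|)⁻¹ ^ 2 ≤ ((1 + |(k : ℝ)|) / 2)⁻¹ ^ 2 := by gcongr
    _ = 4 * (1 + |(k : ℝ)|)⁻¹ ^ 2 := by rw [inv_div, div_eq_mul_inv, mul_pow]; norm_num

/-- Rescaling by `a` loses `min(1, |a|)⁻²`; this loss is affordable because it is later absorbed by
the zero of `m₁`. -/
theorem tsum_int_sub_mul_le (b : ℝ) {a : ℝ} (ha : a ≠ 0) :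
    ∑' k : ℤ, ENNReal.ofReal ((1 + |b - k * a|)⁻¹ ^ 2) ≤
      ENNReal.ofReal ((min 1 |a|)⁻¹ ^ 2) * (4 * intSum) := by
  have hm : 0 < min 1 |a| := lt_min one_pos (abs_pos.2 ha)
  refine le_trans ?_ (mul_le_mul_right (tsum_int_sub_le (b / a)) _)
  rw [← ENNReal.tsum_mul_left]
  refine ENNReal.tsum_le_tsum fun k => ?_
  rw [← ENNReal.ofReal_mul (by positivity), ← mul_pow, ← mul_inv]
  refine ENNReal.ofReal_le_ofReal ?_
  have e : |b - k * a| = |a| * |b / a - k| := by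
    rw [← abs_mul]; congr 1; field_simp
  have h : min 1 |a| * (1 + |b / a - k|) ≤ 1 + |b - k * a| := by
    rw [e, mul_add, mul_one]
    exact add_le_add (min_le_left _ _) (by gcongr; exact min_le_right _ _)
  gcongr

/-- `∑_{i ∈ ℤ} r^{-|i|}`. -/
def geomSum (r : ℝ) : ℝ≥0∞ := ∑' i : ℤ, ENNReal.ofReal (r⁻¹ ^ i.natAbs)

theorem geomSum_ne_top {r : ℝ} (hr : 1 < r) : geomSum r ≠ ⊤ := by
  have hg : Summable fun n : ℕ => r⁻¹ ^ n :=
    summable_geometric_of_lt_one (by positivity) (inv_lt_one_of_one_lt₀ hr)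
  have h : Summable fun i : ℤ => r⁻¹ ^ i.natAbs :=
    Summable.of_nat_of_neg (by simpa using hg) (by simpa using hg)
  exact h.tsum_ofReal_ne_top

/-- If `rⁿ ≤ x < rⁿ⁺¹`, the `j`-th term is at most `r · r^{-|j - n|}`, which makes the bound
independent of `x`. -/
theorem tsum_min_geometric_le {r x : ℝ} (hr : 1 < r) (hx : 1 ≤ x) :
    ∑' j : ℕ, ENNReal.ofReal (min (x / r ^ j) (x / r ^ j)⁻¹) ≤ ENNReal.ofReal r * geomSum r := by
  obtain ⟨n, h1, h2⟩ := exists_nat_pow_near hx hr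
  have hr0 : 0 < r := by linarith
  rw [geomSum, ← ENNReal.tsum_mul_left]
  refine le_trans ?_ (ENNReal.tsum_comp_le_tsum_of_injective
    (f := fun j : ℕ => (j : ℤ) - n) (fun a b h => by simpa using h) _)
  refine ENNReal.tsum_le_tsum fun j => ?_
  rw [← ENNReal.ofReal_mul hr0.le]
  refine ENNReal.ofReal_le_ofReal ?_
  rcases le_total n j with h | h
  · obtain ⟨i, rfl⟩ := Nat.exists_eq_add_of_le h
    have e : (((n + i : ℕ) : ℤ) - n).natAbs = i := by omega
    refine (min_le_left _ _).trans ?_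
    rw [e, inv_pow, pow_add, ← div_eq_mul_inv, div_le_div_iff₀ (by positivity) (by positivity)]
    rw [pow_succ] at h2
    have : 0 < r ^ i := by positivity
    nlinarith
  · obtain ⟨i, rfl⟩ := Nat.exists_eq_add_of_le h
    have e : ((j : ℤ) - (j + i : ℕ)).natAbs = i := by omega
    refine (min_le_right _ _).trans ?_
    rw [e, inv_pow, inv_div, ← div_eq_mul_inv, div_le_div_iff₀ (by positivity) (by positivity)]
    rw [pow_add] at h1
    have h3 : 0 < r ^ j := by positivity
    have h4 : 0 < r ^ i := by positivity
    nlinarith [mul_pos h3 h4]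

/-! ### Overlaps of dilated and sheared functions -/

/-- The overlap function `Φ(ξ, ω)` formed with an arbitrary function `g` in place of `ψ̂`. -/
def overlapSum (α : ℝ) (g : E3 → ℂ) (ξ ω : E3) : ℝ≥0∞ :=
  ∑' p : ScaleShear α,
    ‖g (act ((shearMatrix (-p.1.2)).transpose * scalingMatrix α (-(p.1.1 : ℤ))) ξ)‖ₑ *
      ‖g (act ((shearMatrix (-p.1.2)).transpose * scalingMatrix α (-(p.1.1 : ℤ))) ξ + ω)‖ₑ

theorem act_apply (M : Matrix (Fin 3) (Fin 3) ℝ) (x : E3) (i : Fin 3) :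
    act M x i = M i 0 * x 0 + M i 1 * x 1 + M i 2 * x 2 := by
  simp [act, Matrix.toLpLin_apply, Matrix.mulVec, dotProduct, Fin.sum_univ_three]

theorem two_rpow_neg_mul_div (α : ℝ) (j : ℕ) :
    (2 : ℝ) ^ (((-(j : ℤ) : ℤ) : ℝ) * α / 2) = ((2 ^ (α / 2)) ^ j)⁻¹ := by
  rw [← Real.rpow_natCast, ← Real.rpow_mul (by norm_num), ← Real.rpow_neg (by norm_num)]
  congr 1; push_cast; ring

theorem act_shear_scaling_zero (α : ℝ) (j : ℕ) (k : ℤ × ℤ) (ξ : E3) :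
    act ((shearMatrix (-k)).transpose * scalingMatrix α (-(j : ℤ))) ξ 0 =
      ξ 0 / (2 ^ (α / 2)) ^ j := by
  rw [act_apply, scalingMatrix, two_rpow_neg_mul_div]
  simp [shearMatrix, Matrix.mul_apply, Fin.sum_univ_three, div_eq_inv_mul]

theorem act_shear_scaling_one (α : ℝ) (j : ℕ) (k : ℤ × ℤ) (ξ : E3) :
    act ((shearMatrix (-k)).transpose * scalingMatrix α (-(j : ℤ))) ξ 1 =
      2 ^ (-(j : ℝ) / 2) * ξ 1 - k.1 * (ξ 0 / (2 ^ (α / 2)) ^ j) := by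
  rw [act_apply, scalingMatrix, two_rpow_neg_mul_div]
  simp [shearMatrix, Matrix.mul_apply, Fin.sum_univ_three, div_eq_inv_mul]
  ring

theorem act_shear_scaling_two (α : ℝ) (j : ℕ) (k : ℤ × ℤ) (ξ : E3) :
    act ((shearMatrix (-k)).transpose * scalingMatrix α (-(j : ℤ))) ξ 2 =
      2 ^ (-(j : ℝ) / 2) * ξ 2 - k.2 * (ξ 0 / (2 ^ (α / 2)) ^ j) := by
  rw [act_apply, scalingMatrix, two_rpow_neg_mul_div]
  simp [shearMatrix, Matrix.mul_apply, Fin.sum_univ_three, div_eq_inv_mul]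
  ring

/-- Since `1 + |ω| ≤ (1 + |a|)(1 + |a + ω|)`, two of the three powers buy decay in `ω`. The
remaining one is kept for summing over scales and shears. -/
theorem inv_one_add_abs_pow_mul_le (a ω : ℝ) :
    (1 + |a|)⁻¹ ^ 3 * (1 + |a + ω|)⁻¹ ^ 3 ≤
      (1 + |ω|)⁻¹ ^ 2 * ((1 + |a|)⁻¹ * (1 + |a + ω|)⁻¹) := by
  have h : 1 + |ω| ≤ (1 + |a|) * (1 + |a + ω|) := by
    have h1 : |ω| ≤ |a + ω| + |a| := by
      have := abs_sub (a + ω) a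
      rwa [add_sub_cancel_left] at this
    nlinarith [mul_nonneg (abs_nonneg a) (abs_nonneg (a + ω))]
  calc (1 + |a|)⁻¹ ^ 3 * (1 + |a + ω|)⁻¹ ^ 3
      = ((1 + |a|) * (1 + |a + ω|))⁻¹ ^ 2 * ((1 + |a|)⁻¹ * (1 + |a + ω|)⁻¹) := by
        rw [mul_inv]; ring
    _ ≤ _ := by gcongr

theorem inv_one_add_abs_pow_mul_le_left (a ω : ℝ) :
    (1 + |a|)⁻¹ ^ 3 * (1 + |a + ω|)⁻¹ ^ 3 ≤ (1 + |ω|)⁻¹ ^ 2 * (1 + |a|)⁻¹ := by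
  refine (inv_one_add_abs_pow_mul_le a ω).trans ?_
  gcongr
  refine mul_le_of_le_one_right (by positivity) (inv_le_one_of_one_le₀ ?_)
  linarith [abs_nonneg (a + ω)]

theorem inv_one_add_abs_pow_mul_le_add (a ω : ℝ) :
    (1 + |a|)⁻¹ ^ 3 * (1 + |a + ω|)⁻¹ ^ 3 ≤
      (1 + |ω|)⁻¹ ^ 2 * ((1 + |a|)⁻¹ ^ 2 + (1 + |a + ω|)⁻¹ ^ 2) := by
  refine (inv_one_add_abs_pow_mul_le a ω).trans ?_
  gcongr
  have h1 : 0 ≤ (1 + |a|)⁻¹ := by positivity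
  have h2 : 0 ≤ (1 + |a + ω|)⁻¹ := by positivity
  nlinarith [sq_nonneg ((1 + |a|)⁻¹ - (1 + |a + ω|)⁻¹)]

theorem tsum_shear_le (b ω : ℝ) {a : ℝ} (ha : a ≠ 0) :
    ∑' k : ℤ, ENNReal.ofReal ((1 + |b - k * a|)⁻¹ ^ 2 + (1 + |b - k * a + ω|)⁻¹ ^ 2) ≤
      ENNReal.ofReal ((min 1 |a|)⁻¹ ^ 2) * (8 * intSum) := by
  calc _ = ∑' k : ℤ, (ENNReal.ofReal ((1 + |b - k * a|)⁻¹ ^ 2) +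
        ENNReal.ofReal ((1 + |(b + ω) - k * a|)⁻¹ ^ 2)) := by
        refine tsum_congr fun k => ?_
        rw [ENNReal.ofReal_add (by positivity) (by positivity), add_sub_right_comm]
    _ ≤ ENNReal.ofReal ((min 1 |a|)⁻¹ ^ 2) * (4 * intSum) +
        ENNReal.ofReal ((min 1 |a|)⁻¹ ^ 2) * (4 * intSum) := by
        rw [ENNReal.tsum_add]
        exact add_le_add (tsum_int_sub_mul_le _ ha) (tsum_int_sub_mul_le _ ha)
    _ = _ := by ring

/-- The two shear sums cost `min(1, |a|)⁻⁴`. A zero of order at least five pays for this with one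
power to spare, so the sum over scales converges at both ends. -/
theorem min_one_abs_pow_mul_le {K : ℕ} (hK : 5 ≤ K) {a : ℝ} (ha : a ≠ 0) :
    min 1 |a| ^ K * (1 + |a|)⁻¹ * ((min 1 |a|)⁻¹ ^ 2 * (min 1 |a|)⁻¹ ^ 2) ≤ min |a| |a|⁻¹ := by
  have h0 : 0 < |a| := abs_pos.2 ha
  have hm : 0 < min 1 |a| := lt_min one_pos h0
  have e : min 1 |a| ^ K * (1 + |a|)⁻¹ * ((min 1 |a|)⁻¹ ^ 2 * (min 1 |a|)⁻¹ ^ 2) =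
      min 1 |a| ^ (K - 4) * (1 + |a|)⁻¹ := by
    have : min 1 |a| ^ K = min 1 |a| ^ (K - 4) * min 1 |a| ^ 4 := by
      rw [← pow_add]; congr 1; omega
    rw [this]; field_simp
  rw [e]
  have h1 : min 1 |a| ^ (K - 4) ≤ min 1 |a| :=
    pow_le_of_le_one hm.le (min_le_left _ _) (by omega)
  have h2 : (1 + |a|)⁻¹ ≤ 1 := inv_le_one_of_one_le₀ (by linarith)
  have h3 : (1 + |a|)⁻¹ ≤ |a|⁻¹ := inv_anti₀ h0 (by linarith)
  refine le_min ?_ ?_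
  · calc _ ≤ |a| * 1 := by gcongr; exact h1.trans (min_le_right _ _)
      _ = _ := mul_one _
  · calc _ ≤ 1 * |a|⁻¹ := by gcongr; exact h1.trans (min_le_left _ _)
      _ = _ := one_mul _

/-- The product weight `∏ᵢ (1 + |ωᵢ|)⁻²`. -/
def latticeWeight (ω : E3) : ℝ := (1 + |ω 0|)⁻¹ ^ 2 * (1 + |ω 1|)⁻¹ ^ 2 * (1 + |ω 2|)⁻¹ ^ 2

theorem overlapSum_le {α : ℝ} (hα : 0 < α) {g : E3 → ℂ} {K : ℕ} (hK : 5 ≤ K) {C : ℝ} (hC : 0 ≤ C)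
    (hg : ∀ η : E3, ‖g η‖ ≤ C * (min 1 |η 0| ^ K * (1 + |η 0|)⁻¹ ^ 3 * (1 + |η 1|)⁻¹ ^ 3 *
      (1 + |η 2|)⁻¹ ^ 3)) {ξ : E3} (hξ : 1 ≤ |ξ 0|) (ω : E3) :
    overlapSum α g ξ ω ≤ ENNReal.ofReal (C ^ 2) * ENNReal.ofReal (2 ^ (α / 2)) *
      geomSum (2 ^ (α / 2)) * (8 * intSum) ^ 2 * ENNReal.ofReal (latticeWeight ω) := by
  set r : ℝ := 2 ^ (α / 2) with hr
  have hr1 : 1 < r := Real.one_lt_rpow (by norm_num) (by positivity)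
  have hr0 : 0 < r := by linarith
  have hξ0 : ξ 0 ≠ 0 := abs_pos.1 (by linarith)
  let a : ℕ → ℝ := fun j => ξ 0 / r ^ j
  have ha (j : ℕ) : a j ≠ 0 := div_ne_zero hξ0 (by positivity)
  let b₁ : ℕ → ℝ := fun j => 2 ^ (-(j : ℝ) / 2) * ξ 1
  let b₂ : ℕ → ℝ := fun j => 2 ^ (-(j : ℝ) / 2) * ξ 2
  let F : ℝ → ℝ → ℝ → ℤ → ℝ := fun b ω a k =>
    (1 + |b - k * a|)⁻¹ ^ 2 + (1 + |b - k * a + ω|)⁻¹ ^ 2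
  have hF (b ω a : ℝ) (k : ℤ) : 0 ≤ F b ω a k := by positivity
  let c : ℕ → ℝ := fun j => min 1 |a j| ^ K * (1 + |a j|)⁻¹
  have hc (j : ℕ) : 0 ≤ c j := by positivity
  have hW : 0 ≤ latticeWeight ω := by unfold latticeWeight; positivity
  have hterm (j : ℕ) (k : ℤ × ℤ) :
      ‖g (act ((shearMatrix (-k)).transpose * scalingMatrix α (-(j : ℤ))) ξ)‖ₑ *
        ‖g (act ((shearMatrix (-k)).transpose * scalingMatrix α (-(j : ℤ))) ξ + ω)‖ₑ ≤
      ENNReal.ofReal (C ^ 2 * latticeWeight ω) * (ENNReal.ofReal (c j) *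
        (ENNReal.ofReal (F (b₁ j) (ω 1) (a j) k.1) *
          ENNReal.ofReal (F (b₂ j) (ω 2) (a j) k.2))) := by
    set η := act ((shearMatrix (-k)).transpose * scalingMatrix α (-(j : ℤ))) ξ with hη
    have e0 : η 0 = a j := act_shear_scaling_zero α j k ξ
    have e1 : η 1 = b₁ j - k.1 * a j := act_shear_scaling_one α j k ξ
    have e2 : η 2 = b₂ j - k.2 * a j := act_shear_scaling_two α j k ξ
    rw [← ENNReal.ofReal_mul (hF _ _ _ _), ← ENNReal.ofReal_mul (hc _), ← ENNReal.ofReal_mul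
      (by positivity), ← ofReal_norm, ← ofReal_norm, ← ENNReal.ofReal_mul (norm_nonneg _)]
    refine ENNReal.ofReal_le_ofReal ?_
    refine (mul_le_mul (hg η) (hg (η + ω)) (norm_nonneg _) (by positivity)).trans ?_
    simp only [PiLp.add_apply]
    have i0 := inv_one_add_abs_pow_mul_le_left (η 0) (ω 0)
    have i1 := inv_one_add_abs_pow_mul_le_add (η 1) (ω 1)
    have i2 := inv_one_add_abs_pow_mul_le_add (η 2) (ω 2)
    -- One vanishing factor is enough; the one at the translated point is discarded.
    have i3 : min 1 |η 0 + ω 0| ^ K ≤ 1 := pow_le_one₀ (by positivity) (min_le_left _ _)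
    calc _ = C ^ 2 * (min 1 |η 0| ^ K * min 1 |η 0 + ω 0| ^ K *
          ((1 + |η 0|)⁻¹ ^ 3 * (1 + |η 0 + ω 0|)⁻¹ ^ 3) *
          ((1 + |η 1|)⁻¹ ^ 3 * (1 + |η 1 + ω 1|)⁻¹ ^ 3) *
          ((1 + |η 2|)⁻¹ ^ 3 * (1 + |η 2 + ω 2|)⁻¹ ^ 3)) := by ring
      _ ≤ C ^ 2 * (min 1 |η 0| ^ K * 1 * ((1 + |ω 0|)⁻¹ ^ 2 * (1 + |η 0|)⁻¹) *
          ((1 + |ω 1|)⁻¹ ^ 2 * ((1 + |η 1|)⁻¹ ^ 2 + (1 + |η 1 + ω 1|)⁻¹ ^ 2)) *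
          ((1 + |ω 2|)⁻¹ ^ 2 * ((1 + |η 2|)⁻¹ ^ 2 + (1 + |η 2 + ω 2|)⁻¹ ^ 2))) := by
        gcongr
      _ = _ := by
        simp only [e0, e1, e2, c, F, latticeWeight]; ring
  calc overlapSum α g ξ ω ≤ ∑' p : ScaleShear α, ENNReal.ofReal (C ^ 2 * latticeWeight ω) *
        (ENNReal.ofReal (c p.1.1) * (ENNReal.ofReal (F (b₁ p.1.1) (ω 1) (a p.1.1) p.1.2.1) *
          ENNReal.ofReal (F (b₂ p.1.1) (ω 2) (a p.1.1) p.1.2.2))) :=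
        ENNReal.tsum_le_tsum fun p => hterm p.1.1 p.1.2
    -- For the upper bound the restriction on the shears is dropped, so the sum factors over the two
    -- shear coordinates.
    _ ≤ ∑' p : ℕ × ℤ × ℤ, ENNReal.ofReal (C ^ 2 * latticeWeight ω) *
        (ENNReal.ofReal (c p.1) * (ENNReal.ofReal (F (b₁ p.1) (ω 1) (a p.1) p.2.1) *
          ENNReal.ofReal (F (b₂ p.1) (ω 2) (a p.1) p.2.2))) :=
        ENNReal.tsum_comp_le_tsum_of_injective Subtype.val_injective _
    _ = ENNReal.ofReal (C ^ 2 * latticeWeight ω) * ∑' j : ℕ, ENNReal.ofReal (c j) *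
        ((∑' k : ℤ, ENNReal.ofReal (F (b₁ j) (ω 1) (a j) k)) *
          ∑' k : ℤ, ENNReal.ofReal (F (b₂ j) (ω 2) (a j) k)) := by
        rw [ENNReal.tsum_mul_left, ENNReal.tsum_prod']
        congr 1
        refine tsum_congr fun j => ?_
        dsimp only
        rw [ENNReal.tsum_mul_left, ENNReal.tsum_prod', ← ENNReal.tsum_mul_right]
        congr 1
        exact tsum_congr fun k => by dsimp only; exact ENNReal.tsum_mul_left
    _ ≤ ENNReal.ofReal (C ^ 2 * latticeWeight ω) * ∑' j : ℕ,
        ENNReal.ofReal (min (|ξ 0| / r ^ j) (|ξ 0| / r ^ j)⁻¹) * (8 * intSum) ^ 2 := by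
        refine mul_le_mul_right (ENNReal.tsum_le_tsum fun j => ?_) _
        have hm : 0 < min 1 |a j| := lt_min one_pos (abs_pos.2 (ha j))
        calc _ ≤ ENNReal.ofReal (c j) * ((ENNReal.ofReal ((min 1 |a j|)⁻¹ ^ 2) * (8 * intSum)) *
              (ENNReal.ofReal ((min 1 |a j|)⁻¹ ^ 2) * (8 * intSum))) := by
              gcongr <;> exact tsum_shear_le _ _ (ha j)
          _ = ENNReal.ofReal (c j * ((min 1 |a j|)⁻¹ ^ 2 * (min 1 |a j|)⁻¹ ^ 2)) *
              (8 * intSum) ^ 2 := by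
              rw [ENNReal.ofReal_mul (p := c j) (hc j),
                ENNReal.ofReal_mul (p := (min 1 |a j|)⁻¹ ^ 2) (by positivity)]; ring
          _ ≤ _ := by
              have e : |a j| = |ξ 0| / r ^ j := by
                rw [abs_div, abs_of_pos (pow_pos hr0 j)]
              rw [← e]
              gcongr
              exact min_one_abs_pow_mul_le hK (ha j)
    _ ≤ ENNReal.ofReal (C ^ 2 * latticeWeight ω) *
        (ENNReal.ofReal r * geomSum r * (8 * intSum) ^ 2) := by
        rw [ENNReal.tsum_mul_right]
        gcongr
        exact tsum_min_geometric_le hr1 hξ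
    _ = _ := by rw [ENNReal.ofReal_mul (by positivity)]; ring

theorem one_le_abs_of_mem_pyramid {ξ : E3} (hξ : ξ ∈ pyramid) : 1 ≤ |ξ 0| := by
  rcases hξ with h | h
  · exact h.1.trans (le_abs_self _)
  · have := h.1; exact le_trans (by linarith) (neg_le_abs _)

/-- A single term suffices: the scale puts the first coordinate in `[1/12, 1/6]`, and rounding the
slopes gives shears that bring the other two within half of it. -/
theorem le_overlapSum {α : ℝ} (hα : α ∈ Set.Ioc (1 : ℝ) 2) {g : E3 → ℂ} {ε : ℝ} (hε : 0 ≤ ε)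
    (hg : ∀ η : E3, 1 / 12 ≤ |η 0| → |η 0| ≤ 1 / 6 → |η 1| ≤ |η 0| / 2 → |η 2| ≤ |η 0| / 2 →
      ε ≤ ‖g η‖) {ξ : E3} (hξ : ξ ∈ pyramid) : ENNReal.ofReal (ε ^ 2) ≤ overlapSum α g ξ 0 := by
  have h0 := one_le_abs_of_mem_pyramid hξ
  have hq : |ξ 1 / ξ 0| ≤ 1 ∧ |ξ 2 / ξ 0| ≤ 1 := by rcases hξ with h | h <;> exact h.2
  have hξ0 : ξ 0 ≠ 0 := abs_pos.1 (by linarith)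
  set r : ℝ := 2 ^ (α / 2) with hr
  have hr1 : 1 < r := Real.one_lt_rpow (by norm_num) (by linarith [hα.1])
  have hr2 : r ≤ 2 := by
    refine (Real.rpow_le_rpow_of_exponent_le (by norm_num)
      (by linarith [hα.2] : α / 2 ≤ 1)).trans (by simp)
  -- Because `r ≤ 2`, consecutive scales cannot jump over the annulus `[1/12, 1/6]`; because `|ξ 0|
  -- ≥ 1`, the scale needed is nonnegative.
  obtain ⟨j, hj1, hj2⟩ := exists_nat_pow_near (show 1 ≤ 12 * |ξ 0| by linarith) hr1
  have hrj : 0 < r ^ j := by positivity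
  set a := ξ 0 / r ^ j with ha
  have ha0 : a ≠ 0 := div_ne_zero hξ0 hrj.ne'
  have haa : |a| = |ξ 0| / r ^ j := by rw [ha, abs_div, abs_of_pos hrj]
  have ha1 : 1 / 12 ≤ |a| := by
    rw [haa, le_div_iff₀ hrj]; linarith
  have ha2 : |a| ≤ 1 / 6 := by
    rw [haa, div_le_iff₀ hrj]
    rw [pow_succ] at hj2
    nlinarith
  set s : ℝ := 2 ^ ((j : ℝ) * (α - 1) / 2) with hs
  have hs0 : 0 < s := by positivity
  have key (t : ℝ) (ht : |t / ξ 0| ≤ 1) : ∃ k : ℤ, |k| ≤ ⌈s⌉ ∧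
      |2 ^ (-(j : ℝ) / 2) * t - k * a| ≤ |a| / 2 := by
    have e : 2 ^ (-(j : ℝ) / 2) * t = (s * (t / ξ 0)) * a := by
      have e1 : (2 : ℝ) ^ (-(j : ℝ) / 2) = s * (r ^ j)⁻¹ := by
        rw [hs, hr, ← Real.rpow_natCast, ← Real.rpow_mul (by norm_num),
          ← Real.rpow_neg (by norm_num), ← Real.rpow_add (by norm_num)]
        congr 1; ring
      rw [e1, ha]; field_simp
    have hst : |s * (t / ξ 0)| ≤ s := by
      rw [abs_mul, abs_of_pos hs0]; exact mul_le_of_le_one_right hs0.le ht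
    -- Rounding is monotone and fixes integers, so a number in `[-s, s]` rounds into `[-⌈s⌉, ⌈s⌉]`.
    -- This is why the ceiling in the shear range suffices.
    refine ⟨round (s * (t / ξ 0)), ?_, ?_⟩
    · have h1 := abs_le.1 hst
      have hc := Int.le_ceil s
      rw [abs_le]
      constructor
      · have : round (-(⌈s⌉ : ℝ)) ≤ round (s * (t / ξ 0)) := by
          rw [round_eq, round_eq]; exact Int.floor_le_floor (by linarith)
        have e2 : round (-(⌈s⌉ : ℝ)) = -⌈s⌉ := by exact_mod_cast round_intCast (α := ℝ) (-⌈s⌉)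
        rwa [e2] at this
      · have : round (s * (t / ξ 0)) ≤ round (⌈s⌉ : ℝ) := by
          rw [round_eq, round_eq]; exact Int.floor_le_floor (by linarith)
        rwa [round_intCast] at this
    · rw [e, ← sub_mul, abs_mul]
      have := abs_sub_round (s * (t / ξ 0))
      nlinarith [abs_nonneg a]
  obtain ⟨k₁, hk₁, hk₁'⟩ := key _ hq.1
  obtain ⟨k₂, hk₂, hk₂'⟩ := key _ hq.2
  refine le_trans ?_ (ENNReal.le_tsum (⟨(j, k₁, k₂), hk₁, hk₂⟩ : ScaleShear α))
  simp only [add_zero]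
  set η := act ((shearMatrix (-(k₁, k₂))).transpose * scalingMatrix α (-(j : ℤ))) ξ with hη
  have e0 : η 0 = a := act_shear_scaling_zero α j (k₁, k₂) ξ
  have e1 : η 1 = 2 ^ (-(j : ℝ) / 2) * ξ 1 - k₁ * a := act_shear_scaling_one α j (k₁, k₂) ξ
  have e2 : η 2 = 2 ^ (-(j : ℝ) / 2) * ξ 2 - k₂ * a := act_shear_scaling_two α j (k₁, k₂) ξ
  have hle : ε ≤ ‖g η‖ := hg η (by rwa [e0]) (by rwa [e0]) (by rwa [e0, e1]) (by rwa [e0, e2])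
  rw [← ofReal_norm, ← ENNReal.ofReal_mul (norm_nonneg _), sq]
  exact ENNReal.ofReal_le_ofReal (mul_le_mul hle hle hε (norm_nonneg _))

/-! ### Smallness of `R(c)` for fine sampling. -/

theorem latticeWeight_neg (ω : E3) : latticeWeight (-ω) = latticeWeight ω := by
  simp [latticeWeight]

theorem samplingMatrix_inv {c₁ c₂ : ℝ} (h₁ : c₁ ≠ 0) (h₂ : c₂ ≠ 0) :
    (samplingMatrix c₁ c₂)⁻¹ = samplingMatrix c₁⁻¹ c₂⁻¹ := by
  refine Matrix.inv_eq_right_inv ?_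
  rw [samplingMatrix, samplingMatrix, Matrix.diagonal_mul_diagonal, ← Matrix.diagonal_one]
  congr 1
  ext i
  fin_cases i <;> simp [h₁, h₂]

theorem tsum_prod_three_le (f : ℤ → ℝ≥0∞) :
    ∑' m : Fin 3 → ℤ, f (m 0) * f (m 1) * f (m 2) ≤ (∑' k, f k) ^ 3 := by
  have hinj : Function.Injective fun m : Fin 3 → ℤ => (m 0, m 1, m 2) := by
    intro m n h
    simp only [Prod.mk.injEq] at h
    ext i
    fin_cases i
    exacts [h.1, h.2.1, h.2.2]
  refine (ENNReal.tsum_comp_le_tsum_of_injective hinj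
    fun p : ℤ × ℤ × ℤ => f p.1 * f p.2.1 * f p.2.2).trans (le_of_eq ?_)
  rw [ENNReal.tsum_prod']
  simp only [ENNReal.tsum_prod', ENNReal.tsum_mul_left, ENNReal.tsum_mul_right]
  ring

theorem inv_one_add_abs_div_le {c : ℝ} (hc : 0 < c) (hc1 : c ≤ 1) (x : ℝ) :
    (1 + |x / c|)⁻¹ ≤ (1 + |x|)⁻¹ := by
  have : |x| ≤ |x / c| := by
    rw [abs_div, abs_of_pos hc, le_div_iff₀ hc]
    exact mul_le_of_le_one_right (abs_nonneg _) hc1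
  gcongr

theorem inv_one_add_abs_div_le_mul {c c' : ℝ} (hc : 0 < c) (hcc : c ≤ c') {k : ℤ} (hk : k ≠ 0) :
    (1 + |(k : ℝ) / c|)⁻¹ ^ 2 ≤ 4 * c' ^ 2 * (1 + |(k : ℝ)|)⁻¹ ^ 2 := by
  have h1 : (1 : ℝ) ≤ |(k : ℝ)| := by exact_mod_cast Int.one_le_abs hk
  have h2 : (1 + |(k : ℝ)|) / (2 * c') ≤ 1 + |(k : ℝ) / c| := by
    have h3 : (1 + |(k : ℝ)|) / (2 * c') ≤ (1 + |(k : ℝ)|) / (2 * c) := by gcongr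
    have h4 : (1 + |(k : ℝ)|) / (2 * c) ≤ |(k : ℝ)| / c := by
      rw [div_le_div_iff₀ (by positivity) hc]; nlinarith
    rw [abs_div, abs_of_pos hc]; linarith
  have hc' : 0 < c' := by linarith
  calc (1 + |(k : ℝ) / c|)⁻¹ ^ 2 ≤ ((1 + |(k : ℝ)|) / (2 * c'))⁻¹ ^ 2 := by gcongr
    _ = _ := by rw [inv_div, div_eq_mul_inv]; ring

/-- At least one coordinate of `m` is nonzero, and it alone gains the factor `4c₁²`. The other
coordinates only use `c₂ ≤ c₁ ≤ 1`. -/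
theorem latticeWeight_sampling_le {c₁ c₂ : ℝ} (h₂ : 0 < c₂) (h₂₁ : c₂ ≤ c₁) (h₁ : c₁ ≤ 1)
    {m : Fin 3 → ℤ} (hm : m ≠ 0) :
    latticeWeight (act (samplingMatrix c₁ c₂)⁻¹ (intVec m)) ≤ 4 * c₁ ^ 2 *
      ((1 + |(m 0 : ℝ)|)⁻¹ ^ 2 * (1 + |(m 1 : ℝ)|)⁻¹ ^ 2 * (1 + |(m 2 : ℝ)|)⁻¹ ^ 2) := by
  have hc₁ : 0 < c₁ := by linarith
  have e0 : act (samplingMatrix c₁ c₂)⁻¹ (intVec m) 0 = m 0 / c₁ := by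
    rw [samplingMatrix_inv hc₁.ne' h₂.ne', act_apply]
    simp [samplingMatrix, intVec, div_eq_inv_mul]
  have e1 : act (samplingMatrix c₁ c₂)⁻¹ (intVec m) 1 = m 1 / c₂ := by
    rw [samplingMatrix_inv hc₁.ne' h₂.ne', act_apply]
    simp [samplingMatrix, intVec, div_eq_inv_mul]
  have e2 : act (samplingMatrix c₁ c₂)⁻¹ (intVec m) 2 = m 2 / c₂ := by
    rw [samplingMatrix_inv hc₁.ne' h₂.ne', act_apply]
    simp [samplingMatrix, intVec, div_eq_inv_mul]
  rw [latticeWeight, e0, e1, e2]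
  have b0 := inv_one_add_abs_div_le hc₁ h₁ (m 0)
  have b1 := inv_one_add_abs_div_le h₂ (h₂₁.trans h₁) (m 1)
  have b2 := inv_one_add_abs_div_le h₂ (h₂₁.trans h₁) (m 2)
  by_cases hm0 : m 0 = 0
  · by_cases hm1 : m 1 = 0
    · have hm2 : m 2 ≠ 0 := by
        intro hm2
        refine hm (funext fun i => ?_)
        fin_cases i
        exacts [hm0, hm1, hm2]
      have b3 := inv_one_add_abs_div_le_mul h₂ h₂₁ hm2
      calc _ ≤ (1 + |(m 0 : ℝ)|)⁻¹ ^ 2 * (1 + |(m 1 : ℝ)|)⁻¹ ^ 2 *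
            (4 * c₁ ^ 2 * (1 + |(m 2 : ℝ)|)⁻¹ ^ 2) := by gcongr
        _ = _ := by ring
    · have b3 := inv_one_add_abs_div_le_mul h₂ h₂₁ hm1
      calc _ ≤ (1 + |(m 0 : ℝ)|)⁻¹ ^ 2 * (4 * c₁ ^ 2 * (1 + |(m 1 : ℝ)|)⁻¹ ^ 2) *
            (1 + |(m 2 : ℝ)|)⁻¹ ^ 2 := by gcongr
        _ = _ := by ring
  · have b3 := inv_one_add_abs_div_le_mul hc₁ le_rfl hm0
    calc _ ≤ (4 * c₁ ^ 2 * (1 + |(m 0 : ℝ)|)⁻¹ ^ 2) * (1 + |(m 1 : ℝ)|)⁻¹ ^ 2 *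
          (1 + |(m 2 : ℝ)|)⁻¹ ^ 2 := by gcongr
      _ = _ := by ring

theorem Rsum_le {α : ℝ} {ψ : L2R3} {C : ℝ≥0∞}
    (hC : ∀ ω, maxOverlap α ψ ω ≤ C * ENNReal.ofReal (latticeWeight ω)) {c₁ c₂ : ℝ} (h₂ : 0 < c₂)
    (h₂₁ : c₂ ≤ c₁) (h₁ : c₁ ≤ 1) :
    Rsum α c₁ c₂ ψ ≤ ENNReal.ofReal (c₁ ^ 2) * (4 * C * intSum ^ 3) := by
  let f : ℤ → ℝ≥0∞ := fun k => ENNReal.ofReal ((1 + |(k : ℝ)|)⁻¹ ^ 2)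
  calc Rsum α c₁ c₂ ψ ≤ ∑' m : {m : Fin 3 → ℤ // m ≠ 0},
        ENNReal.ofReal (4 * c₁ ^ 2) * C * (f (m.1 0) * f (m.1 1) * f (m.1 2)) := by
        refine ENNReal.tsum_le_tsum fun m => ?_
        set ω := act (samplingMatrix c₁ c₂)⁻¹ (intVec m.1) with hω
        have h3 : maxOverlap α ψ ω * maxOverlap α ψ (-ω) ≤
            (C * ENNReal.ofReal (latticeWeight ω)) ^ (2 : ℝ) := by
          rw [ENNReal.rpow_two, sq]
          refine mul_le_mul' (hC ω) ?_
          simpa only [latticeWeight_neg] using hC (-ω)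
        refine (ENNReal.rpow_le_rpow h3 (by norm_num)).trans ?_
        rw [← ENNReal.rpow_mul, mul_one_div_cancel two_ne_zero, ENNReal.rpow_one]
        calc C * ENNReal.ofReal (latticeWeight ω) ≤ C * ENNReal.ofReal (4 * c₁ ^ 2 *
              ((1 + |(m.1 0 : ℝ)|)⁻¹ ^ 2 * (1 + |(m.1 1 : ℝ)|)⁻¹ ^ 2 *
                (1 + |(m.1 2 : ℝ)|)⁻¹ ^ 2)) := by
              gcongr; exact latticeWeight_sampling_le h₂ h₂₁ h₁ m.2
          _ = _ := by
              rw [ENNReal.ofReal_mul (p := 4 * c₁ ^ 2) (by positivity),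
                ENNReal.ofReal_mul (p := _ * _) (by positivity),
                ENNReal.ofReal_mul (p := (1 + |(m.1 0 : ℝ)|)⁻¹ ^ 2) (by positivity)]
              ring
    _ ≤ ∑' m : Fin 3 → ℤ, ENNReal.ofReal (4 * c₁ ^ 2) * C * (f (m 0) * f (m 1) * f (m 2)) :=
        ENNReal.tsum_comp_le_tsum_of_injective Subtype.val_injective _
    _ ≤ ENNReal.ofReal (4 * c₁ ^ 2) * C * intSum ^ 3 := by
        rw [ENNReal.tsum_mul_left]
        gcongr
        exact tsum_prod_three_le f
    _ = _ := by
        rw [ENNReal.ofReal_mul (by norm_num), ENNReal.ofReal_ofNat]; ring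

/-! ### Affine changes of variables and the Fourier transform on `L²(ℝ³)` -/

theorem det_toEuclideanLin (T : Matrix (Fin 3) (Fin 3) ℝ) :
    LinearMap.det (Matrix.toEuclideanLin T) = T.det := by
  change LinearMap.det (Matrix.toLpLin 2 2 T) = T.det
  rw [Matrix.toLpLin_eq_toLin, LinearMap.det_toLin]

theorem act_mul (S T : Matrix (Fin 3) (Fin 3) ℝ) (x : E3) : act (S * T) x = act S (act T x) := by
  simp [act, Matrix.toLpLin_apply]

theorem act_one (x : E3) : act 1 x = x := by
  simp [act]

theorem continuous_act (T : Matrix (Fin 3) (Fin 3) ℝ) : Continuous (act T) :=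
  LinearMap.continuous_of_finiteDimensional _

theorem inner_act_left (T : Matrix (Fin 3) (Fin 3) ℝ) (x y : E3) :
    inner ℝ (act T x) y = inner ℝ x (act T.transpose y) := by
  simp only [PiLp.inner_apply, Fin.sum_univ_three, act_apply, Matrix.transpose_apply,
    RCLike.inner_apply, conj_trivial]
  ring

section Affine

variable {T : Matrix (Fin 3) (Fin 3) ℝ} (hT : T.det ≠ 0) (m : E3)

include hT

theorem act_injective : Function.Injective (act T) := by
  intro x y h
  have h1 : act (T⁻¹ * T) x = act (T⁻¹ * T) y := by rw [act_mul, act_mul, h]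
  rwa [Matrix.nonsing_inv_mul _ (isUnit_iff_ne_zero.2 hT), act_one, act_one] at h1

theorem measurableEmbedding_act_sub : MeasurableEmbedding fun x => act T x - m :=
  ((continuous_act T).sub continuous_const).measurableEmbedding
    fun _ _ h => act_injective hT (sub_left_injective h)

theorem map_act_sub : Measure.map (fun x => act T x - m) (volume : Measure E3) =
    ENNReal.ofReal |T.det|⁻¹ • volume := by
  have h1 : Measure.map (act T) (volume : Measure E3) = ENNReal.ofReal |T.det|⁻¹ • volume := by
    rw [Measure.map_linearMap_addHaar_eq_smul_addHaar volume (by rwa [det_toEuclideanLin]),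
      det_toEuclideanLin, abs_inv]
  have h2 : (fun x => act T x - m) = (fun y => y - m) ∘ act T := rfl
  rw [h2, ← Measure.map_map (by fun_prop) (continuous_act T).measurable, h1, Measure.map_smul,
    (measurePreserving_sub_right volume m).map_eq]

theorem lintegral_comp_act_sub (g : E3 → ℝ≥0∞) :
    ∫⁻ x, g (act T x - m) = ENNReal.ofReal |T.det|⁻¹ * ∫⁻ y, g y := by
  rw [← (measurableEmbedding_act_sub hT m).lintegral_map, map_act_sub hT, lintegral_smul_measure,
    smul_eq_mul]

theorem integral_comp_act_sub (g : E3 → ℂ) :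
    ∫ x, g (act T x - m) = (|T.det|⁻¹ : ℝ) * ∫ y, g y := by
  rw [← (measurableEmbedding_act_sub hT m).integral_map, map_act_sub hT, integral_smul_measure,
    ENNReal.toReal_ofReal (by positivity), Complex.real_smul]

theorem quasiMeasurePreserving_act_sub :
    Measure.QuasiMeasurePreserving (fun x => act T x - m) volume volume :=
  ⟨(measurableEmbedding_act_sub hT m).measurable, by
    rw [map_act_sub hT]; exact Measure.smul_absolutelyContinuous⟩

/-- The bounded factor `e` lets one operator serve both sides of the Fourier transform: `e = 1` in
space, a character in frequency. -/
theorem memLp_mul_comp_act_sub {e : E3 → ℂ} (he : Measurable e) (he1 : ∀ x, ‖e x‖ ≤ 1)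
    {f : E3 → ℂ} (hf : MemLp f 2 volume) :
    MemLp (fun x => e x * f (act T x - m)) 2 volume := by
  have h1 : MemLp f 2 (Measure.map (fun x => act T x - m) volume) := by
    rw [map_act_sub hT]
    exact hf.smul_measure ENNReal.ofReal_ne_top
  have h2 : MemLp (fun x => f (act T x - m)) 2 volume :=
    h1.comp_of_map (measurableEmbedding_act_sub hT m).measurable.aemeasurable
  refine h2.mono (he.aestronglyMeasurable.mul h2.1) (Eventually.of_forall fun x => ?_)
  rw [norm_mul]
  exact mul_le_of_le_one_left (norm_nonneg _) (he1 x)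

theorem eLpNorm_mul_comp_act_sub_le {e : E3 → ℂ} (he1 : ∀ x, ‖e x‖ ≤ 1) (f : E3 → ℂ) :
    eLpNorm (fun x => e x * f (act T x - m)) 2 volume ≤
      ENNReal.ofReal |T.det|⁻¹ ^ (1 / (2 : ℝ)) * eLpNorm f 2 volume := by
  calc _ ≤ eLpNorm (fun x => f (act T x - m)) 2 volume := by
        refine eLpNorm_mono fun x => ?_
        rw [norm_mul]
        exact mul_le_of_le_one_left (norm_nonneg _) (he1 x)
    _ = eLpNorm f 2 (Measure.map (fun x => act T x - m) volume) :=
        ((measurableEmbedding_act_sub hT m).eLpNorm_map_measure).symm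
    _ = _ := by
        rw [map_act_sub hT, eLpNorm_smul_measure_of_ne_top (by norm_num)]
        simp

/-- The operator `f ↦ e · f(T · - m)` on `L²(ℝ³)` is continuous. -/
theorem continuous_mul_comp_act_sub {e : E3 → ℂ} (he : Measurable e) (he1 : ∀ x, ‖e x‖ ≤ 1) :
    Continuous fun f : L2R3 => (memLp_mul_comp_act_sub hT m he he1 (Lp.memLp f)).toLp := by
  set D : ℝ≥0∞ := ENNReal.ofReal |T.det|⁻¹ ^ (1 / (2 : ℝ)) with hD
  have hDt : D ≠ ⊤ := ENNReal.rpow_ne_top_of_nonneg (by norm_num) ENNReal.ofReal_ne_top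
  refine LipschitzWith.continuous (K := D.toNNReal) fun f g => ?_
  rw [ENNReal.coe_toNNReal hDt, Lp.edist_toLp_toLp, Lp.edist_def]
  refine le_trans (le_of_eq ?_) (eLpNorm_mul_comp_act_sub_le hT m he1 _)
  congr 1
  ext x
  simp [mul_sub]

theorem fourier_comp_act_sub (f : SchwartzMap E3 ℂ) (ξ : E3) :
    𝓕 (fun x => f (act T x - m)) ξ = (|T.det|⁻¹ : ℝ) *
      (Real.fourierChar (-inner ℝ m (act (T⁻¹).transpose ξ)) *
        𝓕 (f : E3 → ℂ) (act (T⁻¹).transpose ξ)) := by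
  set η := act (T⁻¹).transpose ξ with hη
  have h1 (x : E3) : inner ℝ (act T x - m) η = inner ℝ x ξ - inner ℝ m η := by
    rw [inner_sub_left, inner_act_left, hη, ← act_mul, ← Matrix.transpose_mul,
      Matrix.nonsing_inv_mul _ (isUnit_iff_ne_zero.2 hT), Matrix.transpose_one, act_one]
  rw [Real.fourier_eq, Real.fourier_eq]
  let G : E3 → ℂ := fun y => (Real.fourierChar (-inner ℝ m η) : ℂ) *
    (Real.fourierChar (-inner ℝ y η) • f y)
  have h2 : ∀ x, Real.fourierChar (-inner ℝ x ξ) • f (act T x - m) = G (act T x - m) := by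
    intro x
    dsimp only [G]
    rw [h1, Circle.smul_def, Circle.smul_def, smul_eq_mul, smul_eq_mul, ← mul_assoc,
      ← Circle.coe_mul, ← AddChar.map_add_eq_mul]
    congr 4; ring
  refine (integral_congr_ae (Eventually.of_forall h2)).trans
    ((integral_comp_act_sub hT m G).trans ?_)
  rw [integral_const_mul]

/-- The Fourier transform of `ψ(T · - m)`. -/
theorem fourier_toLp_comp_act_sub (ψ : L2R3) :
    (𝓕 ((memLp_mul_comp_act_sub hT m (e := fun _ => 1) measurable_const (by simp)
      (Lp.memLp ψ)).toLp : L2R3) : L2R3) =ᵐ[volume] fun ξ => (|T.det|⁻¹ : ℝ) *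
      (Real.fourierChar (-inner ℝ m (act (T⁻¹).transpose ξ)) *
        (𝓕 ψ : L2R3) (act (T⁻¹).transpose ξ)) := by
  have hT' : (T⁻¹).transpose.det ≠ 0 := by
    rw [Matrix.det_transpose, Matrix.det_nonsing_inv, Ring.inverse_eq_inv']; exact inv_ne_zero hT
  let e : E3 → ℂ := fun ξ => (Real.fourierChar (-inner ℝ m (act (T⁻¹).transpose ξ)) : ℂ)
  have he : Measurable e := by
    have := (continuous_act (T⁻¹).transpose).measurable
    fun_prop
  have he1 : ∀ ξ, ‖e ξ‖ ≤ 1 := fun ξ => (Circle.norm_coe _).le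
  have key : (𝓕 ((memLp_mul_comp_act_sub hT m (e := fun _ => 1) measurable_const (by simp)
      (Lp.memLp ψ)).toLp : L2R3) : L2R3) = ((|T.det|⁻¹ : ℝ) : ℂ) •
      (memLp_mul_comp_act_sub hT' 0 he he1 (Lp.memLp (𝓕 ψ : L2R3))).toLp := by
    -- Both sides are continuous in `ψ`, so the classical formula on Schwartz functions extends by
    -- density.
    refine DenseRange.induction_on
      (SchwartzMap.denseRange_toLpCLM (E := E3) (F := ℂ) (p := 2) (μ := volume) ENNReal.ofNat_ne_top)
      ψ (isClosed_eq ?_ ?_) fun f => ?_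
    · exact (Lp.fourierTransformₗᵢ E3 ℂ).continuous.comp
        (continuous_mul_comp_act_sub hT m measurable_const (by simp))
    · exact ((continuous_mul_comp_act_sub hT' 0 he he1).comp
        (Lp.fourierTransformₗᵢ E3 ℂ).continuous).const_smul ((|T.det|⁻¹ : ℝ) : ℂ)
    · let A : E3 ≃L[ℝ] E3 := (LinearMap.equivOfDetNeZero (Matrix.toEuclideanLin T)
        (by rwa [det_toEuclideanLin])).toContinuousLinearEquiv
      let g : SchwartzMap E3 ℂ := SchwartzMap.compCLMOfContinuousLinearEquiv ℂ A
        (f.compSubConstCLM ℂ m)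
      have hg (x : E3) : g x = f (act T x - m) := rfl
      have e1 : ((memLp_mul_comp_act_sub hT m (e := fun _ => 1) measurable_const (by simp)
          (Lp.memLp (SchwartzMap.toLpCLM ℝ ℂ 2 volume f))).toLp : L2R3) = g.toLp 2 := by
        refine Lp.ext ?_
        filter_upwards [MemLp.coeFn_toLp (memLp_mul_comp_act_sub hT m (e := fun _ => 1)
          measurable_const (by simp) (Lp.memLp (SchwartzMap.toLpCLM ℝ ℂ 2 volume f))),
          g.coeFn_toLp 2 volume,
          (quasiMeasurePreserving_act_sub hT m).ae (f.coeFn_toLp 2 volume)] with x h1 h2 h3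
        rw [h1, h2, hg, ← h3, one_mul]
        rfl
      rw [e1, SchwartzMap.toLp_fourier_eq, SchwartzMap.toLpCLM_apply, SchwartzMap.toLp_fourier_eq]
      refine Lp.ext ?_
      filter_upwards [(𝓕 g).coeFn_toLp 2 volume, Lp.coeFn_smul ((|T.det|⁻¹ : ℝ) : ℂ)
        (memLp_mul_comp_act_sub hT' 0 he he1 (Lp.memLp ((𝓕 f).toLp 2 : L2R3))).toLp,
        MemLp.coeFn_toLp (memLp_mul_comp_act_sub hT' 0 he he1 (Lp.memLp ((𝓕 f).toLp 2 : L2R3))),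
        (quasiMeasurePreserving_act_sub hT' 0).ae ((𝓕 f).coeFn_toLp 2 volume)] with ξ h1 h2 h3 h4
      rw [h1, h2, Pi.smul_apply, h3, h4, sub_zero, SchwartzMap.fourier_coe, SchwartzMap.fourier_coe,
        smul_eq_mul]
      exact fourier_comp_act_sub hT m f ξ
  rw [key]
  filter_upwards [Lp.coeFn_smul ((|T.det|⁻¹ : ℝ) : ℂ)
      (memLp_mul_comp_act_sub hT' 0 he he1 (Lp.memLp (𝓕 ψ : L2R3))).toLp,
    MemLp.coeFn_toLp (memLp_mul_comp_act_sub hT' 0 he he1 (Lp.memLp (𝓕 ψ : L2R3)))] with ξ h1 h2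
  rw [h1, Pi.smul_apply, h2, smul_eq_mul, sub_zero]

end Affine

/-! ### Correlations of summable families -/

section Correlation

variable {Λ : Type*} [AddCommGroup Λ]

theorem tsum_eq_zero_add_tsum_ne (h : Λ → ℝ≥0∞) :
    ∑' d, h d = h 0 + ∑' d : {d : Λ // d ≠ 0}, h d := by
  have := Summable.tsum_add_tsum_compl (f := h) (s := {0})
    ENNReal.summable ENNReal.summable
  rw [← this, tsum_singleton (0 : Λ) h]
  rfl

theorem tsum_sq_eq_tsum_correlation (a : Λ → ℝ≥0∞) :
    (∑' l, a l) ^ 2 = ∑' d, ∑' l, a l * a (l + d) := by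
  rw [ENNReal.tsum_comm, sq, ← ENNReal.tsum_mul_right]
  refine tsum_congr fun l => ?_
  rw [ENNReal.tsum_mul_left]
  exact congrArg _ ((Equiv.addLeft l).tsum_eq a).symm

theorem enorm_tsum_sq_le (a : Λ → ℂ) : ‖∑' l, a l‖ₑ ^ 2 ≤
    ∑' l, ‖a l‖ₑ ^ 2 + ∑' d : {d : Λ // d ≠ 0}, ∑' l, ‖a l‖ₑ * ‖a (l + d)‖ₑ := by
  calc _ ≤ (∑' l, ‖a l‖ₑ) ^ 2 := by gcongr; exact enorm_tsum_le_tsum_enorm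
    _ = _ := by
      rw [tsum_sq_eq_tsum_correlation, tsum_eq_zero_add_tsum_ne]
      simp [sq]

/-- The autocorrelations `g d` of `a` sum to `|∑ a|²`, and `g 0` is the diagonal. Absolute
summability is needed for rearranging the double series. -/
theorem tsum_enorm_sq_le {a : Λ → ℂ} (h : ∑' l, ‖a l‖ₑ ≠ ⊤) : ∑' l, ‖a l‖ₑ ^ 2 ≤
    ‖∑' l, a l‖ₑ ^ 2 + ∑' d : {d : Λ // d ≠ 0}, ∑' l, ‖a l‖ₑ * ‖a (l + d)‖ₑ := by
  have hs : Summable a := Summable.of_enorm h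
  let f : Λ × Λ → ℂ := fun p => a p.2 * (starRingEnd ℂ) (a (p.2 + p.1))
  have hfe : ∑' p, ‖f p‖ₑ = (∑' l, ‖a l‖ₑ) ^ 2 := by
    rw [tsum_sq_eq_tsum_correlation, ENNReal.tsum_prod']
    simp [f]
  have hf : Summable f := Summable.of_enorm
    (by rw [hfe]; exact ENNReal.pow_ne_top h)
  have hfd (d : Λ) : Summable fun l => f (d, l) := hf.prod_factor d
  let g : Λ → ℂ := fun d => ∑' l, f (d, l)
  have hg : Summable g := hf.prod
  have hsum : ∑' d, g d = (∑' l, a l) * (starRingEnd ℂ) (∑' l, a l) := by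
    have h1 : ∑' d, g d = ∑' l, ∑' d, f (d, l) := (Summable.tsum_comm (f := fun d l => f (d, l)) hf).symm
    rw [h1, ← tsum_mul_right]
    refine tsum_congr fun l => ?_
    simp only [f]
    rw [tsum_mul_left, Complex.conj_tsum]
    exact congrArg _ ((Equiv.addLeft l).tsum_eq fun d => (starRingEnd ℂ) (a d))
  have hg0 : ‖g 0‖ₑ = ∑' l, ‖a l‖ₑ ^ 2 := by
    have h2 : g 0 = ((∑' l, ‖a l‖ ^ 2 : ℝ) : ℂ) := by
      rw [Complex.ofReal_tsum]
      refine tsum_congr fun l => ?_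
      simp [f, Complex.mul_conj, Complex.normSq_eq_norm_sq]
    have h3 : Summable fun l => ‖a l‖ ^ 2 := by
      have := (hfd 0).norm
      simpa [f, sq] using this
    rw [h2, ← ofReal_norm, Complex.norm_real, Real.norm_of_nonneg (tsum_nonneg fun _ => by positivity),
      ENNReal.ofReal_tsum_of_nonneg (fun _ => by positivity) h3]
    refine tsum_congr fun l => ?_
    rw [ENNReal.ofReal_pow (norm_nonneg _), ofReal_norm]
  have hsplit : g 0 = ∑' d, g d - ∑' d : {d : Λ // d ≠ 0}, g d := by
    have := Summable.tsum_add_tsum_compl (f := g) (s := {0})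
      (hg.subtype _) (hg.subtype _)
    rw [tsum_singleton (0 : Λ) g] at this
    exact eq_sub_of_add_eq this
  rw [← hg0, hsplit]
  refine (enorm_sub_le).trans (add_le_add (le_of_eq ?_) ?_)
  · rw [hsum, enorm_mul, RCLike.enorm_conj, sq]
  · refine enorm_tsum_le_tsum_enorm.trans (ENNReal.tsum_le_tsum fun d => ?_)
    refine enorm_tsum_le_tsum_enorm.trans (ENNReal.tsum_le_tsum fun l => ?_)
    simp [f]

end Correlation

/-! ### Periodization and Parseval's identity -/

section Periodization

/-- The Haar probability measure on `ℝ / ℤ`. -/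
local instance : MeasureSpace UnitAddCircle := ⟨AddCircle.haarAddCircle⟩

local instance : IsProbabilityMeasure (volume : Measure UnitAddCircle) :=
  inferInstanceAs (IsProbabilityMeasure AddCircle.haarAddCircle)

variable {d : Type*}

/-- The half-open unit cube `(0, 1]ᵈ`. -/
def unitCube (d : Type*) : Set (d → ℝ) := {x | ∀ i, x i ∈ Set.Ioc (0 : ℝ) (0 + 1)}

/-- An integer vector as an element of `ℝᵈ`. -/
def intShift (l : d → ℤ) : d → ℝ := fun i => (l i : ℝ)

theorem iUnion_unitCube :
    ⋃ l : d → ℤ, (fun x => x + intShift (-l)) ⁻¹' unitCube d = Set.univ := by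
  refine Set.eq_univ_of_forall fun x => Set.mem_iUnion.2 ⟨fun i => ⌈x i⌉ - 1, fun i => ?_⟩
  simp only [intShift, Pi.add_apply, Pi.neg_apply, Set.mem_Ioc]
  push_cast
  have h1 := Int.le_ceil (x i)
  have h2 := Int.ceil_lt_add_one (x i)
  constructor <;> linarith

theorem pairwise_disjoint_unitCube :
    Pairwise (Function.onFun Disjoint fun l : d → ℤ =>
      (fun x => x + intShift (-l)) ⁻¹' unitCube d) := by
  intro l l' hll
  refine Set.disjoint_left.2 fun x hx hx' => hll (funext fun i => ?_)
  have h1 := hx i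
  have h2 := hx' i
  simp only [intShift, Pi.add_apply, Pi.neg_apply, Set.mem_Ioc] at h1 h2
  push_cast at h1 h2
  have h3 : ((l i : ℤ) : ℝ) < l' i + 1 := by linarith [h1.1, h2.2]
  have h4 : ((l' i : ℤ) : ℝ) < l i + 1 := by linarith [h1.2, h2.1]
  have h5 : l i < l' i + 1 := by exact_mod_cast h3
  have h6 : l' i < l i + 1 := by exact_mod_cast h4
  omega

theorem preimage_add_intShift (l : d → ℤ) :
    (fun x => x + intShift l) ⁻¹' ((fun x => x + intShift (-l)) ⁻¹' unitCube d) = unitCube d := by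
  rw [← Set.preimage_comp]
  have : (fun x : d → ℝ => x + intShift (-l)) ∘ (fun x => x + intShift l) = id := by
    ext x i; simp [intShift]
  rw [this, Set.preimage_id]

theorem intShift_add (l l' : d → ℤ) : intShift (l + l') = intShift l + intShift l' := by
  ext i; simp [intShift]

variable [Fintype d]

theorem measurableSet_unitCube : MeasurableSet (unitCube d) :=
  MeasurableSet.univ_pi' fun _ => measurableSet_Ioc

theorem lintegral_eq_tsum_unitCube (g : (d → ℝ) → ℝ≥0∞) :
    ∫⁻ x, g x = ∑' l : d → ℤ, ∫⁻ x in unitCube d, g (x + intShift l) := by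
  rw [← setLIntegral_univ, ← iUnion_unitCube, lintegral_iUnion
    (fun l => (measurable_add_const _) measurableSet_unitCube) pairwise_disjoint_unitCube]
  refine tsum_congr fun l => ?_
  rw [← (measurePreserving_add_right volume (intShift l)).setLIntegral_comp_preimage_emb
    (measurableEmbedding_addRight _), preimage_add_intShift]

theorem integral_eq_tsum_unitCube {g : (d → ℝ) → ℂ} (hg : Integrable g) :
    ∫ x, g x = ∑' l : d → ℤ, ∫ x in unitCube d, g (x + intShift l) := by
  have h := hasSum_integral_iUnion (μ := volume) (f := g)
    (fun l : d → ℤ => (measurable_add_const (intShift (-l))) measurableSet_unitCube)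
    pairwise_disjoint_unitCube hg.integrableOn
  rw [iUnion_unitCube, setIntegral_univ] at h
  rw [← h.tsum_eq]
  refine tsum_congr fun l => ?_
  rw [← (measurePreserving_add_right volume (intShift l)).setIntegral_preimage_emb
    (measurableEmbedding_addRight _), preimage_add_intShift]

/-- The character `x ↦ e^{2πi⟨n, x⟩}` of `ℝᵈ`. -/
def cubeChar (n : d → ℤ) (x : d → ℝ) : ℂ :=
  UnitAddTorus.mFourier n (fun i => (x i : UnitAddCircle))

theorem continuous_cubeChar (n : d → ℤ) : Continuous (cubeChar n) := by
  unfold cubeChar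
  refine (UnitAddTorus.mFourier n).continuous.comp (continuous_pi fun i => ?_)
  exact (AddCircle.continuous_mk' 1).comp (continuous_apply i)

theorem cubeChar_add_intShift (n : d → ℤ) (x : d → ℝ) (l : d → ℤ) :
    cubeChar n (x + intShift l) = cubeChar n x := by
  unfold cubeChar
  congr 1
  ext i
  simp [intShift]

theorem cubeChar_eq (n : d → ℤ) (x : d → ℝ) :
    cubeChar n x = Real.fourierChar (∑ i, (n i : ℝ) * x i) := by
  simp only [cubeChar, UnitAddTorus.mFourier, ContinuousMap.coe_mk, fourier_coe_apply,
    Real.fourierChar_apply, ← Complex.exp_sum]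
  congr 1
  push_cast
  rw [Finset.mul_sum, Finset.sum_mul]
  refine Finset.sum_congr rfl fun i _ => by ring

theorem norm_cubeChar (n : d → ℤ) (x : d → ℝ) : ‖cubeChar n x‖ = 1 := by
  rw [cubeChar_eq, Circle.norm_coe]

/-- Parseval's identity on the unit cube. -/
theorem tsum_sq_integral_cubeChar_mul {G : (d → ℝ) → ℂ}
    (hG : AEStronglyMeasurable G (volume.restrict (unitCube d)))
    (hfin : ∫⁻ x in unitCube d, ‖G x‖ₑ ^ 2 ≠ ⊤) :
    ∑' n : d → ℤ, ‖∫ x in unitCube d, cubeChar n x * G x‖ₑ ^ 2 =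
      ∫⁻ x in unitCube d, ‖G x‖ₑ ^ 2 := by
  let e := UnitAddTorus.measurableEquivPiIoc (fun _ : d => (0 : ℝ))
  let ρ : UnitAddTorus d → d → ℝ := fun t => (e t).1
  have hρ : MeasurePreserving ρ volume (volume.restrict (unitCube d)) := by
    have h1 := UnitAddTorus.measurePreserving_equivPiIoc (fun _ : d => (0 : ℝ))
    have h2 : MeasurePreserving (Subtype.val : unitCube d → d → ℝ)
        (Measure.comap Subtype.val (volume : Measure (d → ℝ)))
        (volume.restrict (unitCube d)) :=
      ⟨measurable_subtype_coe,
        map_comap_subtype_coe (s := unitCube d) measurableSet_unitCube (volume : Measure (d → ℝ))⟩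
    exact h2.comp h1
  have hρx (x : d → ℝ) (hx : x ∈ unitCube d) :
      ρ (fun i => (x i : UnitAddCircle)) = x := by
    have : (fun i => (x i : UnitAddCircle)) = e.symm ⟨x, hx⟩ := rfl
    simp only [ρ, this, MeasurableEquiv.apply_symm_apply]
  let G' : UnitAddTorus d → ℂ := G ∘ ρ
  have hG' : AEStronglyMeasurable G' volume := hG.comp_measurePreserving hρ
  have hl : ∫⁻ t, ‖G' t‖ₑ ^ 2 = ∫⁻ x in unitCube d, ‖G x‖ₑ ^ 2 := by
    rw [UnitAddTorus.lintegral_preimage _ (fun _ => 0)]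
    refine setLIntegral_congr_fun measurableSet_unitCube fun x hx => ?_
    simp only [G', Function.comp_apply, hρx x hx]
  have hmem : MemLp G' 2 volume := by
    refine ⟨hG', ?_⟩
    rw [eLpNorm_lt_top_iff_lintegral_rpow_enorm_lt_top two_ne_zero ENNReal.ofNat_ne_top]
    simp only [ENNReal.toReal_ofNat, ENNReal.rpow_two]
    rw [hl]; exact hfin.lt_top
  have hcoeff (n : d → ℤ) : UnitAddTorus.mFourierCoeff hmem.toLp n =
      ∫ x in unitCube d, cubeChar (-n) x * G x := by
    have h1 : UnitAddTorus.mFourierCoeff hmem.toLp n = UnitAddTorus.mFourierCoeff G' n :=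
      integral_congr_ae (by filter_upwards [hmem.coeFn_toLp] with t ht; rw [ht])
    rw [h1, UnitAddTorus.mFourierCoeff_eq_integral G' n (fun _ => 0)]
    refine setIntegral_congr_fun measurableSet_unitCube fun x hx => ?_
    simp only [G', Function.comp_apply, hρx x hx, smul_eq_mul, cubeChar]
  have hsum := UnitAddTorus.hasSum_sq_mFourierCoeff hmem.toLp
  have hint : ∫ t, ‖(hmem.toLp G') t‖ ^ 2 = (∫⁻ x in unitCube d, ‖G x‖ₑ ^ 2).toReal := by
    have hm : AEStronglyMeasurable (fun t => ‖(hmem.toLp G') t‖ ^ 2) volume :=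
      (Lp.aestronglyMeasurable _).norm.pow 2
    rw [← hl, integral_eq_lintegral_of_nonneg_ae (Eventually.of_forall fun _ => by positivity) hm]
    congr 1
    refine lintegral_congr_ae ?_
    filter_upwards [hmem.coeFn_toLp] with t ht
    rw [ht, ENNReal.ofReal_pow (norm_nonneg _), ofReal_norm]
  -- Fourier coefficients integrate against the character of `-n`, hence the reindexing.
  calc _ = ∑' n : d → ℤ, ‖∫ x in unitCube d, cubeChar (-n) x * G x‖ₑ ^ 2 :=
        ((Equiv.neg (d → ℤ)).tsum_eq fun n =>
          ‖∫ x in unitCube d, cubeChar n x * G x‖ₑ ^ 2).symm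
    _ = ∑' n : d → ℤ, ENNReal.ofReal (‖UnitAddTorus.mFourierCoeff hmem.toLp n‖ ^ 2) := by
        refine tsum_congr fun n => ?_
        rw [hcoeff, ENNReal.ofReal_pow (norm_nonneg _), ofReal_norm]
    _ = ENNReal.ofReal (∫ t, ‖(hmem.toLp G') t‖ ^ 2) := by
        rw [← hsum.tsum_eq, ENNReal.ofReal_tsum_of_nonneg (fun _ => by positivity) hsum.summable]
    _ = _ := by rw [hint, ENNReal.ofReal_toReal hfin]

section Correlation

variable {F : (d → ℝ) → ℂ}

theorem lintegral_sq_unitCube (hF : Measurable F) :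
    ∫⁻ x in unitCube d, ∑' l : d → ℤ, ‖F (x + intShift l)‖ₑ ^ 2 = ∫⁻ x, ‖F x‖ₑ ^ 2 := by
  rw [lintegral_tsum fun l => by fun_prop, lintegral_eq_tsum_unitCube]

theorem lintegral_correlation_unitCube (hF : Measurable F) :
    ∫⁻ x in unitCube d, ∑' k : {k : d → ℤ // k ≠ 0}, ∑' l : d → ℤ,
      ‖F (x + intShift l)‖ₑ * ‖F (x + intShift (l + k.1))‖ₑ =
    ∑' k : {k : d → ℤ // k ≠ 0}, ∫⁻ x, ‖F x‖ₑ * ‖F (x + intShift k)‖ₑ := by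
  rw [lintegral_tsum fun k => by fun_prop]
  refine tsum_congr fun k => ?_
  rw [lintegral_tsum fun l => by fun_prop, lintegral_eq_tsum_unitCube]
  simp only [intShift_add, add_assoc]

/-- Fourier coefficients of a function and its correlations with its integer translates. -/
theorem tsum_sq_integral_cubeChar (hF : Measurable F) (hint : Integrable F)
    (hI : ∫⁻ x, ‖F x‖ₑ ^ 2 ≠ ⊤)
    (hJ : ∑' k : {k : d → ℤ // k ≠ 0}, ∫⁻ x, ‖F x‖ₑ * ‖F (x + intShift k)‖ₑ ≠ ⊤) :
    (∑' n : d → ℤ, ‖∫ x, cubeChar n x * F x‖ₑ ^ 2 ≤ (∫⁻ x, ‖F x‖ₑ ^ 2) +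
      ∑' k : {k : d → ℤ // k ≠ 0}, ∫⁻ x, ‖F x‖ₑ * ‖F (x + intShift k)‖ₑ) ∧
    (∫⁻ x, ‖F x‖ₑ ^ 2 ≤ ∑' n : d → ℤ, ‖∫ x, cubeChar n x * F x‖ₑ ^ 2 +
      ∑' k : {k : d → ℤ // k ≠ 0}, ∫⁻ x, ‖F x‖ₑ * ‖F (x + intShift k)‖ₑ) := by
  -- The Fourier coefficients of this periodization are the integrals of `F` against integer
  -- characters over the whole space. Finiteness of the two correlation quantities makes `G` square
  -- integrable on the cube.
  let G : (d → ℝ) → ℂ := fun x => ∑' l : d → ℤ, F (x + intShift l)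
  have hsumfin : ∑' l : d → ℤ, ∫⁻ x in unitCube d, ‖F (x + intShift l)‖ₑ ≠ ⊤ := by
    rw [← lintegral_eq_tsum_unitCube fun x => ‖F x‖ₑ]
    exact hint.2.ne
  have hae : ∀ᵐ x ∂(volume.restrict (unitCube d)), ∑' l : d → ℤ, ‖F (x + intShift l)‖ₑ ≠ ⊤ := by
    have h1 : ∫⁻ x in unitCube d, ∑' l : d → ℤ, ‖F (x + intShift l)‖ₑ ≠ ⊤ := by
      rwa [lintegral_tsum fun l => by fun_prop]
    filter_upwards [ae_lt_top (by fun_prop) h1] with x hx using hx.ne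
  have hG : AEStronglyMeasurable G (volume.restrict (unitCube d)) := by
    refine aestronglyMeasurable_of_tendsto_ae (atTop : Filter (Finset (d → ℤ)))
      (f := fun s x => ∑ l ∈ s, F (x + intShift l))
      (fun s => (Measurable.aestronglyMeasurable (by fun_prop))) ?_
    filter_upwards [hae] with x hx using (Summable.of_enorm hx).hasSum
  have hupper : ∫⁻ x in unitCube d, ‖G x‖ₑ ^ 2 ≤ (∫⁻ x, ‖F x‖ₑ ^ 2) +
      ∑' k : {k : d → ℤ // k ≠ 0}, ∫⁻ x, ‖F x‖ₑ * ‖F (x + intShift k)‖ₑ := by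
    rw [← lintegral_sq_unitCube hF, ← lintegral_correlation_unitCube hF,
      ← lintegral_add_left (by fun_prop)]
    exact lintegral_mono fun x => enorm_tsum_sq_le fun l : d → ℤ => F (x + intShift l)
  have hlower : ∫⁻ x, ‖F x‖ₑ ^ 2 ≤ (∫⁻ x in unitCube d, ‖G x‖ₑ ^ 2) +
      ∑' k : {k : d → ℤ // k ≠ 0}, ∫⁻ x, ‖F x‖ₑ * ‖F (x + intShift k)‖ₑ := by
    rw [← lintegral_sq_unitCube hF, ← lintegral_correlation_unitCube hF,
      ← lintegral_add_right _ (by fun_prop)]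
    refine lintegral_mono_ae ?_
    filter_upwards [hae] with x hx
    exact tsum_enorm_sq_le hx
  have hpars := tsum_sq_integral_cubeChar_mul hG
    (ne_top_of_le_ne_top (ENNReal.add_ne_top.2 ⟨hI, hJ⟩) hupper)
  have hcoeff (n : d → ℤ) : ∫ x in unitCube d, cubeChar n x * G x = ∫ x, cubeChar n x * F x := by
    have hm : Measurable (cubeChar n) := (continuous_cubeChar n).measurable
    have hint' : Integrable fun x => cubeChar n x * F x :=
      hint.bdd_mul (c := 1) hm.aestronglyMeasurable
        (Eventually.of_forall fun x => (norm_cubeChar n x).le)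
    have henorm (x : d → ℝ) : ‖cubeChar n x‖ₑ = 1 := by
      rw [← ofReal_norm, norm_cubeChar, ENNReal.ofReal_one]
    rw [integral_eq_tsum_unitCube hint', ← integral_tsum]
    · refine integral_congr_ae (Eventually.of_forall fun x => ?_)
      simp only [G, cubeChar_add_intShift, tsum_mul_left]
    · intro l
      exact Measurable.aestronglyMeasurable (by fun_prop)
    · simpa only [enorm_mul, henorm, one_mul] using hsumfin
  simp only [hcoeff] at hpars
  rw [hpars]
  exact ⟨hupper, hlower⟩

end Correlation

end Periodization

/-! ### The coefficients at a fixed scale and shear -/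

theorem lintegral_toLp (g : E3 → ℝ≥0∞) : ∫⁻ x : Fin 3 → ℝ, g (WithLp.toLp 2 x) = ∫⁻ y, g y :=
  (PiLp.volume_preserving_toLp (Fin 3)).lintegral_comp_emb
    (MeasurableEquiv.toLp 2 (Fin 3 → ℝ)).measurableEmbedding g

theorem integral_toLp (g : E3 → ℂ) : ∫ x : Fin 3 → ℝ, g (WithLp.toLp 2 x) = ∫ y, g y :=
  (PiLp.volume_preserving_toLp (Fin 3)).integral_comp
    (MeasurableEquiv.toLp 2 (Fin 3 → ℝ)).measurableEmbedding g

theorem lintegral_comp_act {T : Matrix (Fin 3) (Fin 3) ℝ} (hT : T.det ≠ 0) (g : E3 → ℝ≥0∞) :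
    ∫⁻ x, g (act T x) = ENNReal.ofReal |T.det|⁻¹ * ∫⁻ y, g y := by
  simpa using lintegral_comp_act_sub hT 0 g

theorem integral_comp_act {T : Matrix (Fin 3) (Fin 3) ℝ} (hT : T.det ≠ 0) (g : E3 → ℂ) :
    ∫ x, g (act T x) = (|T.det|⁻¹ : ℝ) * ∫ y, g y := by
  simpa using integral_comp_act_sub hT 0 g

theorem memLp_comp_act {T : Matrix (Fin 3) (Fin 3) ℝ} (hT : T.det ≠ 0) (f : L2R3) :
    MemLp (fun x => f (act T x)) 2 volume := by
  simpa using memLp_mul_comp_act_sub hT 0 (e := fun _ => 1) measurable_const (by simp) (Lp.memLp f)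

theorem cubeChar_ofLp (n : Fin 3 → ℤ) (y : E3) :
    cubeChar n (WithLp.ofLp y) = Real.fourierChar (inner ℝ (intVec n) y) := by
  rw [cubeChar_eq]
  simp [PiLp.inner_apply, intVec, mul_comm]

theorem act_add (T : Matrix (Fin 3) (Fin 3) ℝ) (x y : E3) : act T (x + y) = act T x + act T y :=
  map_add _ _ _

theorem measurable_coeFn (f : L2R3) : Measurable f := (Lp.stronglyMeasurable f).measurable

theorem act_inv_sampled (T : Matrix (Fin 3) (Fin 3) ℝ) {M : Matrix (Fin 3) (Fin 3) ℝ}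
    (hM : M.det ≠ 0) (ξ : E3) :
    act M⁻¹ (act (M * (T⁻¹).transpose) ξ) = act (T⁻¹).transpose ξ := by
  rw [← act_mul, ← Matrix.mul_assoc, Matrix.nonsing_inv_mul _ (isUnit_iff_ne_zero.2 hM), one_mul]

section FixedScale

variable {T M : Matrix (Fin 3) (Fin 3) ℝ} (hT : T.det ≠ 0) (hM : M.det ≠ 0)

include hT hM

theorem det_sampled_ne_zero : (M * (T⁻¹).transpose).det ≠ 0 := by
  rw [Matrix.det_mul, Matrix.det_transpose, Matrix.det_nonsing_inv, Ring.inverse_eq_inv']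
  exact mul_ne_zero hM (inv_ne_zero hT)

theorem act_dual_sampled (ξ : E3) :
    act (T.transpose * M⁻¹) (act (M * (T⁻¹).transpose) ξ) = ξ := by
  rw [act_mul, act_inv_sampled T hM, ← act_mul, ← Matrix.transpose_mul,
    Matrix.nonsing_inv_mul _ (isUnit_iff_ne_zero.2 hT), Matrix.transpose_one, act_one]

theorem det_dual_sampled_ne_zero : (T.transpose * M⁻¹).det ≠ 0 := by
  rw [Matrix.det_mul, Matrix.det_transpose, Matrix.det_nonsing_inv, Ring.inverse_eq_inv']
  exact mul_ne_zero hT (inv_ne_zero hM)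

/-- Two-sided estimate of the coefficients `⟨f, vₙ⟩` of a function against the translates of one
dilated generator, in terms of `u = 𝓕 f` and `w = 𝓕 ψ`. -/
theorem tsum_sq_inner_bounds (hMt : M.transpose = M) {c : ℝ} (hc : c ^ 2 = |T.det|)
    (f w : L2R3) (v : (Fin 3 → ℤ) → L2R3)
    (hv : ∀ n, (𝓕 (v n) : L2R3) =ᵐ[volume] fun ξ => (c : ℂ) * ((|T.det|⁻¹ : ℝ) *
      (Real.fourierChar (-inner ℝ (act M (intVec n)) (act (T⁻¹).transpose ξ)) *
        w (act (T⁻¹).transpose ξ))))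
    {I J : ℝ≥0∞}
    (hI : I = ∫⁻ ξ, ‖(𝓕 f : L2R3) ξ‖ₑ ^ 2 * (‖w (act (T⁻¹).transpose ξ)‖ₑ *
      ‖w (act (T⁻¹).transpose ξ)‖ₑ))
    (hJ : J = ∑' l : {l : Fin 3 → ℤ // l ≠ 0}, ∫⁻ ξ, ‖(𝓕 f : L2R3) ξ‖ₑ *
      ‖(𝓕 f : L2R3) (ξ + act (T.transpose * M⁻¹) (intVec l))‖ₑ *
      (‖w (act (T⁻¹).transpose ξ)‖ₑ * ‖w (act (T⁻¹).transpose ξ + act M⁻¹ (intVec l))‖ₑ))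
    (hI' : I ≠ ⊤) (hJ' : J ≠ ⊤) :
    (∑' n, ‖inner ℂ (v n) f‖ₑ ^ 2 ≤ ENNReal.ofReal |M.det|⁻¹ * (I + J)) ∧
      (ENNReal.ofReal |M.det|⁻¹ * I ≤
        ∑' n, ‖inner ℂ (v n) f‖ₑ ^ 2 + ENNReal.ofReal |M.det|⁻¹ * J) := by
  set B := (T⁻¹).transpose with hB
  set Q := T.transpose * M⁻¹ with hQ
  set P := M * B with hP
  set u : L2R3 := 𝓕 f with hu
  have hPd : P.det ≠ 0 := det_sampled_ne_zero hT hM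
  have hQd : Q.det ≠ 0 := det_dual_sampled_ne_zero hT hM
  have hMd : M⁻¹.det ≠ 0 := by
    rw [Matrix.det_nonsing_inv, Ring.inverse_eq_inv']; exact inv_ne_zero hM
  have hQP (ξ : E3) : act Q (act P ξ) = ξ := act_dual_sampled hT hM ξ
  have hMP (ξ : E3) : act M⁻¹ (act P ξ) = act B ξ := act_inv_sampled T hM ξ
  -- In the variable `y = Pξ` the characters attached to the sampling points become integer
  -- characters. An integer shift of `y` moves the argument of `u` by `Q l` and that of `w` by `M⁻¹
  -- l`.
  let F₀ : E3 → ℂ := fun y => u (act Q y) * (starRingEnd ℂ) (w (act M⁻¹ y))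
  let F : (Fin 3 → ℝ) → ℂ := fun x => F₀ (WithLp.toLp 2 x)
  have hF₀ : Measurable F₀ := by
    have h1 := (measurable_coeFn u).comp (continuous_act Q).measurable
    have h2 := (measurable_coeFn w).comp (continuous_act M⁻¹).measurable
    exact h1.mul (Complex.continuous_conj.measurable.comp h2)
  have hF : Measurable F := hF₀.comp (MeasurableEquiv.toLp 2 (Fin 3 → ℝ)).measurable
  have hF₀i : Integrable F₀ :=
    (memLp_comp_act hQd u).integrable_mul (memLp_comp_act hMd w).star
  have hFi : Integrable F :=
    (PiLp.volume_preserving_toLp (Fin 3)).integrable_comp_of_integrable hF₀i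
  have hdP : ENNReal.ofReal |P.det| * ENNReal.ofReal |P.det|⁻¹ = 1 := by
    rw [← ENNReal.ofReal_mul (abs_nonneg _), mul_inv_cancel₀ (abs_ne_zero.2 hPd),
      ENNReal.ofReal_one]
  have hchange (g : E3 → ℝ≥0∞) :
      ∫⁻ y, g y = ENNReal.ofReal |P.det| * ∫⁻ ξ, g (act P ξ) := by
    rw [lintegral_comp_act hPd, ← mul_assoc, hdP, one_mul]
  have hIF : ∫⁻ x, ‖F x‖ₑ ^ 2 = ENNReal.ofReal |P.det| * I := by
    rw [lintegral_toLp fun y => ‖F₀ y‖ₑ ^ 2, hchange, hI]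
    simp only [F₀, hQP, hMP, enorm_mul, RCLike.enorm_conj, mul_pow]
    simp only [sq]
  have hJF : ∑' l : {l : Fin 3 → ℤ // l ≠ 0}, ∫⁻ x, ‖F x‖ₑ * ‖F (x + intShift l)‖ₑ =
      ENNReal.ofReal |P.det| * J := by
    rw [hJ, ← ENNReal.tsum_mul_left]
    refine tsum_congr fun l => ?_
    have h1 (x : Fin 3 → ℝ) : F (x + intShift l) = F₀ (WithLp.toLp 2 x + intVec l) := rfl
    simp only [h1]
    rw [lintegral_toLp fun y => ‖F₀ y‖ₑ * ‖F₀ (y + intVec l)‖ₑ, hchange]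
    congr 1
    refine lintegral_congr fun ξ => ?_
    simp only [F₀, act_add, hQP, hMP, enorm_mul, RCLike.enorm_conj]
    ring
  have hinner (n : Fin 3 → ℤ) : inner ℂ (v n) f =
      ((c * |T.det|⁻¹ * |P.det|⁻¹ : ℝ) : ℂ) * ∫ x, cubeChar n x * F x := by
    rw [← Lp.inner_fourier_eq, L2.inner_def]
    let H : E3 → ℂ := fun y => (Real.fourierChar (inner ℝ (intVec n) y) : ℂ) * F₀ y
    have h2 : ∫ ξ, inner ℂ ((𝓕 (v n) : L2R3) ξ) (u ξ) =
        ∫ ξ, ((c * |T.det|⁻¹ : ℝ) : ℂ) * H (act P ξ) := by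
      refine integral_congr_ae ?_
      filter_upwards [hv n] with ξ hξ
      have h3 : inner ℝ (act M (intVec n)) (act B ξ) = inner ℝ (intVec n) (act P ξ) := by
        rw [inner_act_left, hMt, ← act_mul]
      simp only [RCLike.inner_apply, hξ, H, F₀, hQP, hMP, map_mul, Complex.conj_ofReal, h3]
      rw [AddChar.map_neg_eq_inv, Circle.coe_inv_eq_conj, Complex.conj_conj]
      push_cast
      ring
    rw [h2, integral_const_mul, integral_comp_act hPd, ← integral_toLp]
    have h4 (x : Fin 3 → ℝ) : H (WithLp.toLp 2 x) = cubeChar n x * F x := by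
      simp only [H, F, ← cubeChar_ofLp]
    simp only [h4]
    push_cast
    ring
  -- The normalization `c² = |det T|` is exactly what removes all dependence on scale and shear.
  have hconst : (c * |T.det|⁻¹ * |P.det|⁻¹) ^ 2 * |P.det| = |M.det|⁻¹ := by
    have h5 : |P.det| = |M.det| * |T.det|⁻¹ := by
      rw [hP, hB, Matrix.det_mul, Matrix.det_transpose, Matrix.det_nonsing_inv,
        Ring.inverse_eq_inv', abs_mul, abs_inv]
    have h6 : |T.det| ≠ 0 := abs_ne_zero.2 hT
    have h7 : |M.det| ≠ 0 := abs_ne_zero.2 hM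
    rw [mul_pow, mul_pow, hc, h5]
    field_simp
  have hN : ∑' n, ‖inner ℂ (v n) f‖ₑ ^ 2 = ENNReal.ofReal ((c * |T.det|⁻¹ * |P.det|⁻¹) ^ 2) *
      ∑' n, ‖∫ x, cubeChar n x * F x‖ₑ ^ 2 := by
    rw [← ENNReal.tsum_mul_left]
    refine tsum_congr fun n => ?_
    rw [hinner, enorm_mul, mul_pow, ← ofReal_norm, Complex.norm_real, Real.norm_eq_abs,
      ← ENNReal.ofReal_pow (abs_nonneg _), sq_abs]
  obtain ⟨hup, hlo⟩ := tsum_sq_integral_cubeChar hF hFi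
    (by rw [hIF]; exact ENNReal.mul_ne_top ENNReal.ofReal_ne_top hI')
    (by rw [hJF]; exact ENNReal.mul_ne_top ENNReal.ofReal_ne_top hJ')
  rw [hIF, hJF] at hup hlo
  rw [hN, ← hconst, ENNReal.ofReal_mul (sq_nonneg _)]
  constructor
  · calc _ ≤ ENNReal.ofReal ((c * |T.det|⁻¹ * |P.det|⁻¹) ^ 2) *
          (ENNReal.ofReal |P.det| * I + ENNReal.ofReal |P.det| * J) := by gcongr
      _ = _ := by ring
  · calc _ = ENNReal.ofReal ((c * |T.det|⁻¹ * |P.det|⁻¹) ^ 2) *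
          (ENNReal.ofReal |P.det| * I) := by ring
      _ ≤ ENNReal.ofReal ((c * |T.det|⁻¹ * |P.det|⁻¹) ^ 2) *
          (∑' n, ‖∫ x, cubeChar n x * F x‖ₑ ^ 2 + ENNReal.ofReal |P.det| * J) := by gcongr
      _ = _ := by ring

end FixedScale

/-! ### Cauchy–Schwarz for sums of integrals -/

/-- Cauchy–Schwarz with the weight split as `s = √s · √s`. -/
theorem lintegral_mul_mul_le {X : Type*} [MeasurableSpace X] (μ : Measure X) {a b s : X → ℝ≥0∞}
    (ha : Measurable a) (hb : Measurable b) (hs : Measurable s) :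
    ∫⁻ x, a x * b x * s x ∂μ ≤
      (∫⁻ x, a x ^ 2 * s x ∂μ) ^ (1 / 2 : ℝ) * (∫⁻ x, b x ^ 2 * s x ∂μ) ^ (1 / 2 : ℝ) := by
  have hsq (t : ℝ≥0∞) : (t ^ (1 / 2 : ℝ)) ^ 2 = t := by
    rw [← ENNReal.rpow_natCast, ← ENNReal.rpow_mul]; norm_num
  have h := ENNReal.lintegral_mul_le_Lp_mul_Lq μ Real.HolderConjugate.two_two
    (f := fun x => a x * s x ^ (1 / 2 : ℝ)) (g := fun x => b x * s x ^ (1 / 2 : ℝ))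
    (by fun_prop) (by fun_prop)
  simp only [Pi.mul_apply, ENNReal.rpow_two, mul_pow, hsq] at h
  refine le_trans (le_of_eq (lintegral_congr fun x => ?_)) h
  calc a x * b x * s x = a x * b x * (s x ^ (1 / 2 : ℝ)) ^ 2 := by rw [hsq]
    _ = _ := by ring

theorem tsum_rpow_mul_rpow_le {ι : Type*} (a b : ι → ℝ≥0∞) :
    ∑' p, a p ^ (1 / 2 : ℝ) * b p ^ (1 / 2 : ℝ) ≤
      (∑' p, a p) ^ (1 / 2 : ℝ) * (∑' p, b p) ^ (1 / 2 : ℝ) := by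
  have hsq (t : ℝ≥0∞) : (t ^ (1 / 2 : ℝ)) ^ 2 = t := by
    rw [← ENNReal.rpow_natCast, ← ENNReal.rpow_mul]; norm_num
  let _ : MeasurableSpace ι := ⊤
  have h := lintegral_mul_mul_le (Measure.count : Measure ι) (a := fun p => a p ^ (1 / 2 : ℝ))
    (b := fun p => b p ^ (1 / 2 : ℝ)) (s := fun _ => 1) measurable_from_top measurable_from_top
    measurable_from_top
  simpa only [hsq, mul_one, lintegral_count' measurable_from_top] using h

theorem tsum_lintegral_mul_mul_le {ι X : Type*} [MeasurableSpace X] (μ : Measure X)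
    {a b s : ι → X → ℝ≥0∞} (ha : ∀ p, Measurable (a p)) (hb : ∀ p, Measurable (b p))
    (hs : ∀ p, Measurable (s p)) :
    ∑' p, ∫⁻ x, a p x * b p x * s p x ∂μ ≤
      (∑' p, ∫⁻ x, a p x ^ 2 * s p x ∂μ) ^ (1 / 2 : ℝ) *
        (∑' p, ∫⁻ x, b p x ^ 2 * s p x ∂μ) ^ (1 / 2 : ℝ) :=
  (ENNReal.tsum_le_tsum fun p => lintegral_mul_mul_le μ (ha p) (hb p) (hs p)).trans
    (tsum_rpow_mul_rpow_le _ _)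

/-! ### The shearlet system on the Fourier side -/

theorem samplingMatrix_det (c₁ c₂ : ℝ) : (samplingMatrix c₁ c₂).det = c₁ * c₂ * c₂ := by
  simp [samplingMatrix, Matrix.det_diagonal, Fin.prod_univ_three]

theorem samplingMatrix_transpose (c₁ c₂ : ℝ) :
    (samplingMatrix c₁ c₂).transpose = samplingMatrix c₁ c₂ :=
  Matrix.diagonal_transpose _

theorem scalingMatrix_mul_neg (α : ℝ) (j : ℤ) :
    scalingMatrix α j * scalingMatrix α (-j) = 1 := by
  rw [scalingMatrix, scalingMatrix, Matrix.diagonal_mul_diagonal, ← Matrix.diagonal_one]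
  congr 1
  ext i
  fin_cases i <;>
    simp [← Real.rpow_add, neg_div]

theorem shearMatrix_mul_neg (k : ℤ × ℤ) : shearMatrix k * shearMatrix (-k) = 1 := by
  ext i j
  fin_cases i <;> fin_cases j <;> simp [shearMatrix, Matrix.mul_apply, Fin.sum_univ_three]

theorem shear_mul_scaling_inv_transpose (α : ℝ) (j : ℤ) (k : ℤ × ℤ) :
    ((shearMatrix k * scalingMatrix α j)⁻¹).transpose =
      (shearMatrix (-k)).transpose * scalingMatrix α (-j) := by
  have h : (shearMatrix k * scalingMatrix α j)⁻¹ = scalingMatrix α (-j) * shearMatrix (-k) := by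
    refine Matrix.inv_eq_right_inv ?_
    rw [Matrix.mul_assoc, ← Matrix.mul_assoc (scalingMatrix α j), scalingMatrix_mul_neg,
      Matrix.one_mul, shearMatrix_mul_neg]
  rw [h, Matrix.transpose_mul]
  congr 1
  exact Matrix.diagonal_transpose _

theorem sq_two_rpow_eq_abs_det (α : ℝ) (j : ℕ) (k : ℤ × ℤ) :
    ((2 : ℝ) ^ ((j : ℝ) * (α + 2) / 4)) ^ 2 = |(shearMatrix k * scalingMatrix α j).det| := by
  have h1 : (shearMatrix k * scalingMatrix α j).det = (2 : ℝ) ^ ((j : ℝ) * (α + 2) / 2) := by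
    rw [Matrix.det_mul]
    have h2 : (shearMatrix k).det = 1 := by simp [shearMatrix, Matrix.det_fin_three]
    have h3 : (scalingMatrix α j).det = (2 : ℝ) ^ ((j : ℝ) * (α + 2) / 2) := by
      simp only [scalingMatrix, Matrix.det_diagonal, Fin.prod_univ_three, Matrix.cons_val_zero,
        Matrix.cons_val_one, Matrix.cons_val, Int.cast_natCast]
      rw [← Real.rpow_add two_pos, ← Real.rpow_add two_pos]
      congr 1; ring
    rw [h2, h3, one_mul]
  rw [h1, abs_of_pos (by positivity), ← Real.rpow_natCast, ← Real.rpow_mul two_pos.le]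
  congr 1; push_cast; ring

theorem fourier_shearletSystem (α c₁ c₂ : ℝ) (ψ : L2R3) (p : ScaleShear α) (n : Fin 3 → ℤ) :
    (𝓕 (shearletSystem α c₁ c₂ ψ (p, n)) : L2R3) =ᵐ[volume] fun ξ =>
      (((2 : ℝ) ^ ((p.1.1 : ℝ) * (α + 2) / 4) : ℝ) : ℂ) *
        ((|(shearMatrix p.1.2 * scalingMatrix α p.1.1).det|⁻¹ : ℝ) *
          (Real.fourierChar (-inner ℝ (act (samplingMatrix c₁ c₂) (intVec n))
            (act ((shearMatrix p.1.2 * scalingMatrix α p.1.1)⁻¹).transpose ξ)) *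
          (𝓕 ψ : L2R3) (act ((shearMatrix p.1.2 * scalingMatrix α p.1.1)⁻¹).transpose ξ))) := by
  set T := shearMatrix p.1.2 * scalingMatrix α p.1.1
  have hT : T.det ≠ 0 := det_shear_mul_scaling_ne_zero α p.1.1 p.1.2
  set m := act (samplingMatrix c₁ c₂) (intVec n)
  set c : ℂ := (((2 : ℝ) ^ ((p.1.1 : ℝ) * (α + 2) / 4) : ℝ) : ℂ)
  set g : L2R3 := (memLp_mul_comp_act_sub hT m (e := fun _ => 1) measurable_const (by simp)
      (Lp.memLp ψ)).toLp with hg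
  have h1 : shearletSystem α c₁ c₂ ψ (p, n) = c • g := by
    refine Lp.ext ?_
    filter_upwards [Lp.coeFn_smul c g, MemLp.coeFn_toLp (memLp_mul_comp_act_sub hT m
      (e := fun _ => 1) measurable_const (by simp) (Lp.memLp ψ)),
      MemLp.coeFn_toLp (memLp_shearletFun α (Lp.memLp ψ) p.1.1 p.1.2 m)] with x h2 h3 h4
    rw [h2, Pi.smul_apply, hg, h3, one_mul]
    exact h4
  have h2 : (𝓕 (c • g) : L2R3) = c • 𝓕 g := (Lp.fourierTransformₗᵢ E3 ℂ).map_smul c g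
  rw [h1, h2]
  filter_upwards [Lp.coeFn_smul c (𝓕 g : L2R3), fourier_toLp_comp_act_sub hT m ψ] with ξ h3 h4
  rw [h3, Pi.smul_apply, h4, smul_eq_mul]

/-! ### Frame inequalities -/

theorem lintegral_enorm_sq_fourier (f : L2R3) :
    ∫⁻ ξ, ‖(𝓕 f : L2R3) ξ‖ₑ ^ 2 = ENNReal.ofReal (‖f‖ ^ 2) := by
  rw [← Lp.norm_fourier_eq f, ENNReal.ofReal_pow (norm_nonneg _), ofReal_norm, Lp.enorm_def,
    eLpNorm_eq_lintegral_rpow_enorm_toReal two_ne_zero ENNReal.ofNat_ne_top]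
  simp only [ENNReal.toReal_ofNat, ENNReal.rpow_two]
  rw [← ENNReal.rpow_natCast, ← ENNReal.rpow_mul]
  norm_num

theorem measurable_overlap_term (ψ : L2R3) (B : Matrix (Fin 3) (Fin 3) ℝ) (ω : E3) :
    Measurable fun ξ => ‖(𝓕 ψ : L2R3) (act B ξ)‖ₑ * ‖(𝓕 ψ : L2R3) (act B ξ + ω)‖ₑ := by
  have h1 := measurable_coeFn (𝓕 ψ : L2R3)
  have h2 := (continuous_act B).measurable
  fun_prop

theorem tsum_lintegral_overlap (α : ℝ) (ψ f : L2R3) (ω : E3) :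
    ∑' p : ScaleShear α, ∫⁻ ξ, ‖(𝓕 f : L2R3) ξ‖ₑ ^ 2 *
      (‖(𝓕 ψ : L2R3) (act ((shearMatrix (-p.1.2)).transpose *
        scalingMatrix α (-(p.1.1 : ℤ))) ξ)‖ₑ *
      ‖(𝓕 ψ : L2R3) (act ((shearMatrix (-p.1.2)).transpose *
        scalingMatrix α (-(p.1.1 : ℤ))) ξ + ω)‖ₑ) =
    ∫⁻ ξ, ‖(𝓕 f : L2R3) ξ‖ₑ ^ 2 * overlap α ψ ξ ω := by
  have h1 := measurable_coeFn (𝓕 f : L2R3)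
  simp only [overlap, ← ENNReal.tsum_mul_left]
  exact (lintegral_tsum fun p =>
    ((h1.enorm.pow_const 2).mul (measurable_overlap_term ψ _ ω)).aemeasurable).symm

theorem lintegral_overlap_le (α : ℝ) (ψ : L2R3) {f : L2R3} (hf : f ∈ pyramidSpace) (ω : E3) :
    ∫⁻ ξ, ‖(𝓕 f : L2R3) ξ‖ₑ ^ 2 * overlap α ψ ξ ω ≤
      maxOverlap α ψ ω * ENNReal.ofReal (‖f‖ ^ 2) := by
  have h1 := measurable_coeFn (𝓕 f : L2R3)
  rw [← lintegral_enorm_sq_fourier, ← lintegral_const_mul _ (h1.enorm.pow_const 2)]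
  refine lintegral_mono_ae ?_
  filter_upwards [hf, ae_imp_of_ae_restrict
    (ENNReal.ae_le_essSup (μ := volume.restrict pyramid) fun ξ => overlap α ψ ξ ω)] with ξ h2 h3
  by_cases h : ξ ∈ pyramid
  · rw [mul_comm]
    exact mul_le_mul_left (h3 h) _
  · simp [h2 h]

theorem le_lintegral_overlap (α : ℝ) (ψ : L2R3) {f : L2R3} (hf : f ∈ pyramidSpace) :
    Linf α ψ * ENNReal.ofReal (‖f‖ ^ 2) ≤ ∫⁻ ξ, ‖(𝓕 f : L2R3) ξ‖ₑ ^ 2 * overlap α ψ ξ 0 := by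
  have h1 := measurable_coeFn (𝓕 f : L2R3)
  rw [← lintegral_enorm_sq_fourier, ← lintegral_const_mul _ (h1.enorm.pow_const 2)]
  refine lintegral_mono_ae ?_
  filter_upwards [hf, ae_imp_of_ae_restrict
    (ae_essInf_le (μ := volume.restrict pyramid) (f := fun ξ => overlap α ψ ξ 0))] with ξ h2 h3
  by_cases h : ξ ∈ pyramid
  · rw [mul_comm]
    exact mul_le_mul_right (h3 h) _
  · simp [h2 h]

section FrameBounds

variable {α c₁ c₂ : ℝ} (h₁ : c₁ ≠ 0) (h₂ : c₂ ≠ 0) (ψ : L2R3) {f : L2R3}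
  (hf : f ∈ pyramidSpace)

/-- The correlation at the lattice point `l` summed over scales and shears. -/
theorem tsum_correlation_le (hf : f ∈ pyramidSpace) (l : Fin 3 → ℤ) :
    ∑' p : ScaleShear α, ∫⁻ ξ, ‖(𝓕 f : L2R3) ξ‖ₑ *
      ‖(𝓕 f : L2R3) (ξ + act ((shearMatrix p.1.2 * scalingMatrix α p.1.1).transpose *
        (samplingMatrix c₁ c₂)⁻¹) (intVec l))‖ₑ *
      (‖(𝓕 ψ : L2R3) (act ((shearMatrix (-p.1.2)).transpose *
          scalingMatrix α (-(p.1.1 : ℤ))) ξ)‖ₑ *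
        ‖(𝓕 ψ : L2R3) (act ((shearMatrix (-p.1.2)).transpose *
          scalingMatrix α (-(p.1.1 : ℤ))) ξ + act (samplingMatrix c₁ c₂)⁻¹ (intVec l))‖ₑ) ≤
    (maxOverlap α ψ (act (samplingMatrix c₁ c₂)⁻¹ (intVec l)) *
      maxOverlap α ψ (-act (samplingMatrix c₁ c₂)⁻¹ (intVec l))) ^ (1 / 2 : ℝ) *
      ENNReal.ofReal (‖f‖ ^ 2) := by
  set ω := act (samplingMatrix c₁ c₂)⁻¹ (intVec l) with hω
  set u : L2R3 := 𝓕 f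
  set w : L2R3 := 𝓕 ψ
  set E := ENNReal.ofReal (‖f‖ ^ 2)
  have hu := measurable_coeFn u
  let B : ScaleShear α → Matrix (Fin 3) (Fin 3) ℝ := fun p =>
    (shearMatrix (-p.1.2)).transpose * scalingMatrix α (-(p.1.1 : ℤ))
  let q : ScaleShear α → E3 := fun p =>
    act ((shearMatrix p.1.2 * scalingMatrix α p.1.1).transpose *
      (samplingMatrix c₁ c₂)⁻¹) (intVec l)
  -- The shift of `f̂` varies with scale and shear, but the dual matrix carries it to the same `ω`
  -- every time. Translating by it therefore turns the second Cauchy–Schwarz factor into the overlap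
  -- at `-ω`.
  have hBq (p : ScaleShear α) : act (B p) (q p) = ω := by
    simp only [B, q]
    rw [← shear_mul_scaling_inv_transpose, act_mul, ← act_mul, ← Matrix.transpose_mul,
      Matrix.mul_nonsing_inv _ (isUnit_iff_ne_zero.2 (det_shear_mul_scaling_ne_zero α _ _)),
      Matrix.transpose_one, act_one]
  have hcs := tsum_lintegral_mul_mul_le (volume : Measure E3)
    (a := fun (_ : ScaleShear α) ξ => ‖u ξ‖ₑ) (b := fun p ξ => ‖u (ξ + q p)‖ₑ)
    (s := fun p ξ => ‖w (act (B p) ξ)‖ₑ * ‖w (act (B p) ξ + ω)‖ₑ)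
    (fun _ => hu.enorm) (fun p => by fun_prop) (fun p => measurable_overlap_term ψ _ ω)
  refine hcs.trans ?_
  have e1 : ∑' p : ScaleShear α, ∫⁻ ξ, ‖u ξ‖ₑ ^ 2 *
      (‖w (act (B p) ξ)‖ₑ * ‖w (act (B p) ξ + ω)‖ₑ) ≤ maxOverlap α ψ ω * E :=
    (tsum_lintegral_overlap α ψ f ω).le.trans (lintegral_overlap_le α ψ hf ω)
  have e2 : ∑' p : ScaleShear α, ∫⁻ ξ, ‖u (ξ + q p)‖ₑ ^ 2 *
      (‖w (act (B p) ξ)‖ₑ * ‖w (act (B p) ξ + ω)‖ₑ) ≤ maxOverlap α ψ (-ω) * E := by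
    refine le_trans (le_of_eq ?_)
      ((tsum_lintegral_overlap α ψ f (-ω)).le.trans (lintegral_overlap_le α ψ hf (-ω)))
    refine tsum_congr fun p => ?_
    rw [← lintegral_add_right_eq_self (μ := (volume : Measure E3)) (fun ξ => ‖u ξ‖ₑ ^ 2 *
      (‖w (act (B p) ξ)‖ₑ * ‖w (act (B p) ξ + -ω)‖ₑ)) (q p)]
    refine lintegral_congr fun ξ => ?_
    rw [act_add, hBq, add_neg_cancel_right, mul_comm ‖w (act (B p) ξ)‖ₑ]
  calc _ ≤ (maxOverlap α ψ ω * E) ^ (1 / 2 : ℝ) * (maxOverlap α ψ (-ω) * E) ^ (1 / 2 : ℝ) := by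
        gcongr
    _ = _ := by
        rw [← ENNReal.mul_rpow_of_nonneg _ _ (by norm_num : (0 : ℝ) ≤ 1 / 2),
          show maxOverlap α ψ ω * E * (maxOverlap α ψ (-ω) * E) =
            maxOverlap α ψ ω * maxOverlap α ψ (-ω) * E ^ 2 by ring,
          ENNReal.mul_rpow_of_nonneg _ _ (by norm_num : (0 : ℝ) ≤ 1 / 2), ← ENNReal.rpow_natCast E,
          ← ENNReal.rpow_mul]
        norm_num

include h₁ h₂ hf

/-- The two-sided frame estimate in terms of the covering quantities. -/
theorem frameSum_bounds (hL : Lsup α ψ ≠ ⊤) (hR : Rsum α c₁ c₂ ψ ≠ ⊤) :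
    (frameSum (shearletSystem α c₁ c₂ ψ) f ≤ ENNReal.ofReal |(samplingMatrix c₁ c₂).det|⁻¹ *
      ((Lsup α ψ + Rsum α c₁ c₂ ψ) * ENNReal.ofReal (‖f‖ ^ 2))) ∧
    (ENNReal.ofReal |(samplingMatrix c₁ c₂).det|⁻¹ * (Linf α ψ * ENNReal.ofReal (‖f‖ ^ 2)) ≤
      frameSum (shearletSystem α c₁ c₂ ψ) f + ENNReal.ofReal |(samplingMatrix c₁ c₂).det|⁻¹ *
        (Rsum α c₁ c₂ ψ * ENNReal.ofReal (‖f‖ ^ 2))) := by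
  set M := samplingMatrix c₁ c₂ with hMdef
  have hM : M.det ≠ 0 := by
    rw [hMdef, samplingMatrix_det]; exact mul_ne_zero (mul_ne_zero h₁ h₂) h₂
  set D := ENNReal.ofReal |M.det|⁻¹
  set E := ENNReal.ofReal (‖f‖ ^ 2)
  let I : ScaleShear α → ℝ≥0∞ := fun p => ∫⁻ ξ, ‖(𝓕 f : L2R3) ξ‖ₑ ^ 2 *
      (‖(𝓕 ψ : L2R3) (act ((shearMatrix (-p.1.2)).transpose *
        scalingMatrix α (-(p.1.1 : ℤ))) ξ)‖ₑ *
      ‖(𝓕 ψ : L2R3) (act ((shearMatrix (-p.1.2)).transpose *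
        scalingMatrix α (-(p.1.1 : ℤ))) ξ)‖ₑ)
  let J : ScaleShear α → ℝ≥0∞ := fun p => ∑' l : {l : Fin 3 → ℤ // l ≠ 0},
    ∫⁻ ξ, ‖(𝓕 f : L2R3) ξ‖ₑ *
      ‖(𝓕 f : L2R3) (ξ + act ((shearMatrix p.1.2 * scalingMatrix α p.1.1).transpose *
        M⁻¹) (intVec l))‖ₑ *
      (‖(𝓕 ψ : L2R3) (act ((shearMatrix (-p.1.2)).transpose *
          scalingMatrix α (-(p.1.1 : ℤ))) ξ)‖ₑ *
        ‖(𝓕 ψ : L2R3) (act ((shearMatrix (-p.1.2)).transpose *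
          scalingMatrix α (-(p.1.1 : ℤ))) ξ + act M⁻¹ (intVec l))‖ₑ)
  have hIeq : ∑' p, I p = ∫⁻ ξ, ‖(𝓕 f : L2R3) ξ‖ₑ ^ 2 * overlap α ψ ξ 0 := by
    rw [← tsum_lintegral_overlap]
    simp only [I, add_zero]
  have hIle : ∑' p, I p ≤ Lsup α ψ * E := hIeq.trans_le (lintegral_overlap_le α ψ hf 0)
  have hIge : Linf α ψ * E ≤ ∑' p, I p := (le_lintegral_overlap α ψ hf).trans_eq hIeq.symm
  have hJle : ∑' p, J p ≤ Rsum α c₁ c₂ ψ * E := by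
    simp only [J]
    rw [ENNReal.tsum_comm, Rsum, ← ENNReal.tsum_mul_right]
    exact ENNReal.tsum_le_tsum fun l => tsum_correlation_le ψ hf l.1
  have hItop : ∑' p, I p ≠ ⊤ :=
    ne_top_of_le_ne_top (ENNReal.mul_ne_top hL ENNReal.ofReal_ne_top) hIle
  have hJtop : ∑' p, J p ≠ ⊤ :=
    ne_top_of_le_ne_top (ENNReal.mul_ne_top hR ENNReal.ofReal_ne_top) hJle
  have hp (p : ScaleShear α) := tsum_sq_inner_bounds (det_shear_mul_scaling_ne_zero α p.1.1 p.1.2)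
    hM (samplingMatrix_transpose c₁ c₂) (sq_two_rpow_eq_abs_det α p.1.1 p.1.2) f (𝓕 ψ : L2R3)
    (fun n => shearletSystem α c₁ c₂ ψ (p, n)) (fun n => fourier_shearletSystem α c₁ c₂ ψ p n)
    (I := I p) (J := J p) (by rw [shear_mul_scaling_inv_transpose])
    (by rw [shear_mul_scaling_inv_transpose]) (ENNReal.ne_top_of_tsum_ne_top hItop p)
    (ENNReal.ne_top_of_tsum_ne_top hJtop p)
  have hframe : frameSum (shearletSystem α c₁ c₂ ψ) f =
      ∑' p, ∑' n, ‖inner ℂ (shearletSystem α c₁ c₂ ψ (p, n)) f‖ₑ ^ 2 := by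
    rw [frameSum, ENNReal.tsum_prod']
  constructor
  · calc frameSum (shearletSystem α c₁ c₂ ψ) f ≤ ∑' p, D * (I p + J p) :=
          hframe.trans_le (ENNReal.tsum_le_tsum fun p => (hp p).1)
      _ = D * (∑' p, I p + ∑' p, J p) := by rw [ENNReal.tsum_mul_left, ENNReal.tsum_add]
      _ ≤ D * (Lsup α ψ * E + Rsum α c₁ c₂ ψ * E) := by gcongr
      _ = _ := by ring
  · calc D * (Linf α ψ * E) ≤ D * ∑' p, I p := by gcongr
      _ = ∑' p, D * I p := by rw [ENNReal.tsum_mul_left]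
      _ ≤ ∑' p, (∑' n, ‖inner ℂ (shearletSystem α c₁ c₂ ψ (p, n)) f‖ₑ ^ 2 + D * J p) :=
          ENNReal.tsum_le_tsum fun p => (hp p).2
      _ = frameSum (shearletSystem α c₁ c₂ ψ) f + D * ∑' p, J p := by
          rw [ENNReal.tsum_add, hframe, ENNReal.tsum_mul_left]
      _ ≤ _ := by gcongr

end FrameBounds

/-! ### Optimal frame bounds -/

section Optimal

variable {ι H : Type*} [NormedAddCommGroup H] [InnerProductSpace ℂ H] {W : Submodule ℂ H}
  {v : ι → H}

theorem isClosed_lowerFrameBounds : IsClosed {a | IsLowerFrameBound W v a} := by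
  simp only [IsLowerFrameBound, Set.ofPred_forall]
  refine isClosed_iInter fun f => isClosed_iInter fun _ => ?_
  exact isClosed_Iic.preimage (f := fun a : ℝ => ENNReal.ofReal (a * ‖f‖ ^ 2))
    (ENNReal.continuous_ofReal.comp (by fun_prop))

theorem isClosed_upperFrameBounds : IsClosed {b | IsUpperFrameBound W v b} := by
  simp only [IsUpperFrameBound, Set.ofPred_forall]
  refine isClosed_iInter fun f => isClosed_iInter fun _ => ?_
  exact isClosed_Ici.preimage (f := fun a : ℝ => ENNReal.ofReal (a * ‖f‖ ^ 2))
    (ENNReal.continuous_ofReal.comp (by fun_prop))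

/-- `ENNReal.ofReal` truncates negative numbers to zero, so a strictly positive lower bound is used
to force `b > 0` before real numbers are compared. -/
theorem IsLowerFrameBound.le_upper {A₀ a b : ℝ} (hA₀ : 0 < A₀) (hl : IsLowerFrameBound W v A₀)
    (ha : IsLowerFrameBound W v a) (hb : IsUpperFrameBound W v b) {f : H} (hf : f ∈ W)
    (hf0 : f ≠ 0) : a ≤ b := by
  have hn : 0 < ‖f‖ ^ 2 := by positivity
  have h1 := ENNReal.ofReal_le_ofReal_iff'.1 ((hl f hf).trans (hb f hf))
  have h2 := ENNReal.ofReal_le_ofReal_iff'.1 ((ha f hf).trans (hb f hf))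
  have h3 : 0 < A₀ * ‖f‖ ^ 2 := by positivity
  have h4 : 0 < b * ‖f‖ ^ 2 := by rcases h1 with h | h <;> linarith
  have h5 : a * ‖f‖ ^ 2 ≤ b * ‖f‖ ^ 2 := by rcases h2 with h | h <;> linarith
  exact le_of_mul_le_mul_right h5 hn

/-- Frame bounds on a nontrivial subspace can be improved to optimal ones. -/
theorem exists_optimal_frameBounds {A₀ B₀ : ℝ} (hA₀ : 0 < A₀) (hl : IsLowerFrameBound W v A₀)
    (hu : IsUpperFrameBound W v B₀) {f : H} (hf : f ∈ W) (hf0 : f ≠ 0) :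
    ∃ A B : ℝ, IsGreatest {a | IsLowerFrameBound W v a} A ∧
      IsLeast {b | IsUpperFrameBound W v b} B ∧ A₀ ≤ A ∧ A ≤ B ∧ B ≤ B₀ := by
  have hle {a b : ℝ} (ha : IsLowerFrameBound W v a) (hb : IsUpperFrameBound W v b) : a ≤ b :=
    hl.le_upper hA₀ ha hb hf hf0
  have hba : BddAbove {a | IsLowerFrameBound W v a} := ⟨B₀, fun a ha => hle ha hu⟩
  have hbb : BddBelow {b | IsUpperFrameBound W v b} := ⟨A₀, fun b hb => hle hl hb⟩
  have hA : IsGreatest {a | IsLowerFrameBound W v a} (sSup {a | IsLowerFrameBound W v a}) :=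
    isClosed_lowerFrameBounds.isGreatest_csSup ⟨A₀, hl⟩ hba
  have hB : IsLeast {b | IsUpperFrameBound W v b} (sInf {b | IsUpperFrameBound W v b}) :=
    isClosed_upperFrameBounds.isLeast_csInf ⟨B₀, hu⟩ hbb
  exact ⟨_, _, hA, hB, hA.2 hl, hle hA.1 hB.1, hB.2 hu⟩

end Optimal

/-! ### The pyramid -/

theorem measurableSet_pyramid : MeasurableSet pyramid := by
  have h (i : Fin 3) : Measurable fun ξ : E3 => ξ i := by fun_prop
  have hq (i : Fin 3) : MeasurableSet {ξ : E3 | |ξ i / ξ 0| ≤ 1} :=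
    measurableSet_le (continuous_abs.measurable.comp ((h i).div (h 0))) measurable_const
  exact ((measurableSet_le measurable_const (h 0)).inter ((hq 1).inter (hq 2))).union
    ((measurableSet_le (h 0) measurable_const).inter ((hq 1).inter (hq 2)))

theorem ball_subset_pyramid : Metric.ball (!₂[2, 0, 0] : E3) (1 / 2) ⊆ pyramid := by
  intro ξ hξ
  rw [Metric.mem_ball, dist_eq_norm] at hξ
  have h (i : Fin 3) := (PiLp.norm_apply_le (ξ - !₂[2, 0, 0]) i).trans hξ.le
  have h0 := h 0
  have h1 := h 1
  have h2 := h 2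
  simp only [PiLp.sub_apply, Real.norm_eq_abs, Matrix.cons_val_zero, Matrix.cons_val_one,
    Matrix.cons_val, sub_zero] at h0 h1 h2
  have h0' := abs_le.1 h0
  have hp : 0 < ξ 0 := by linarith [h0'.1]
  refine Or.inl ⟨by linarith [h0'.1], ?_, ?_⟩ <;>
  · rw [abs_div, abs_of_pos hp, div_le_one hp]
    linarith [h0'.1]

/-- The inverse Fourier transform of the indicator of a ball inside the pyramid. Without a nonzero
element, optimal bounds would not exist. -/
theorem exists_mem_pyramidSpace_ne_zero : ∃ f ∈ pyramidSpace, f ≠ 0 := by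
  set s := Metric.ball (!₂[2, 0, 0] : E3) (1 / 2)
  have hs : volume s ≠ ⊤ := measure_ball_lt_top.ne
  set g : L2R3 := indicatorConstLp 2 (measurableSet_ball (x := (!₂[2, 0, 0] : E3))) hs (1 : ℂ)
  have hg : (𝓕 ((Lp.fourierTransformₗᵢ E3 ℂ).symm g) : L2R3) = g :=
    (Lp.fourierTransformₗᵢ E3 ℂ).apply_symm_apply g
  refine ⟨(Lp.fourierTransformₗᵢ E3 ℂ).symm g, ?_, ?_⟩
  · change ∀ᵐ ξ ∂(volume : Measure E3), ξ ∉ pyramid →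
      (𝓕 ((Lp.fourierTransformₗᵢ E3 ℂ).symm g) : L2R3) ξ = 0
    rw [hg]
    filter_upwards [indicatorConstLp_coeFn (p := 2) (hs := measurableSet_ball) (hμs := hs)
      (c := (1 : ℂ))] with ξ h1 h2
    rw [h1, Set.indicator_of_notMem fun h => h2 (ball_subset_pyramid h)]
  · rw [Ne, LinearIsometryEquiv.map_eq_zero_iff, ← norm_eq_zero,
      norm_indicatorConstLp two_ne_zero ENNReal.ofNat_ne_top]
    have : 0 < volume.real s :=
      ENNReal.toReal_pos (Metric.measure_ball_pos volume _ (by norm_num)).ne' hs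
    rw [norm_one, one_mul]
    exact (Real.rpow_pos_of_pos this _).ne'

/-! ### The generator -/

theorem memLp_two_of_decay {E : Type*} [NormedAddCommGroup E] [NormedSpace ℝ E]
    [FiniteDimensional ℝ E] [MeasurableSpace E] [BorelSpace E] (μ : Measure E)
    [μ.IsAddHaarMeasure] (hE : Module.finrank ℝ E < 6) {g : E → ℂ} (hg : Measurable g) {C : ℝ}
    (hC : ∀ x, ‖g x‖ ≤ C * (1 + ‖x‖)⁻¹ ^ 3) : MemLp g 2 μ := by
  rw [memLp_two_iff_integrable_sq_norm hg.aestronglyMeasurable]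
  have h1 : Integrable (fun x : E => C ^ 2 * (1 + ‖x‖) ^ (-(6 : ℝ))) μ :=
    (integrable_one_add_norm (by exact_mod_cast hE)).const_mul _
  refine h1.mono' (hg.norm.pow_const 2).aestronglyMeasurable (Eventually.of_forall fun x => ?_)
  rw [Real.norm_of_nonneg (by positivity)]
  calc ‖g x‖ ^ 2 ≤ (C * (1 + ‖x‖)⁻¹ ^ 3) ^ 2 := by gcongr; exact hC x
    _ = C ^ 2 * (1 + ‖x‖) ^ (-(6 : ℝ)) := by
      rw [Real.rpow_neg (by positivity), mul_pow, ← pow_mul, inv_pow]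
      norm_cast

theorem one_add_norm_le (η : E3) : 1 + ‖η‖ ≤ (1 + |η 0|) * (1 + |η 1|) * (1 + |η 2|) := by
  have h : ‖η‖ ≤ |η 0| + |η 1| + |η 2| := by
    rw [EuclideanSpace.norm_eq, Fin.sum_univ_three]
    refine Real.sqrt_le_iff.2 ⟨by positivity, ?_⟩
    simp only [Real.norm_eq_abs]
    nlinarith [mul_nonneg (abs_nonneg (η 0)) (abs_nonneg (η 1)),
      mul_nonneg (abs_nonneg (η 0)) (abs_nonneg (η 2)),
      mul_nonneg (abs_nonneg (η 1)) (abs_nonneg (η 2))]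
  have h0 := abs_nonneg (η 0)
  have h1 := abs_nonneg (η 1)
  have h2 := abs_nonneg (η 2)
  have h01 := mul_nonneg h0 h1
  have h02 := mul_nonneg h0 h2
  have h12 := mul_nonneg h1 h2
  have h012 := mul_nonneg h01 h2
  nlinarith

theorem exists_fourier_ae_eq {E : Type*} [NormedAddCommGroup E] [InnerProductSpace ℝ E]
    [FiniteDimensional ℝ E] [MeasurableSpace E] [BorelSpace E] {g : E → ℂ}
    (hg : MemLp g 2 volume) :
    ∃ φ : Lp (α := E) ℂ 2 volume, (𝓕 φ : Lp (α := E) ℂ 2 volume) =ᵐ[volume] g := by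
  refine ⟨(Lp.fourierTransformₗᵢ E ℂ).symm hg.toLp, ?_⟩
  have h : (𝓕 ((Lp.fourierTransformₗᵢ E ℂ).symm hg.toLp) : Lp (α := E) ℂ 2 volume) = hg.toLp :=
    (Lp.fourierTransformₗᵢ E ℂ).apply_symm_apply _
  rw [h]
  exact hg.coeFn_toLp

/-- There are countably many scales and shears, and each nonsingular affine map pulls null sets back
to null sets. -/
theorem ae_overlap_eq (α : ℝ) {ψ : L2R3} {g : E3 → ℂ} (h : (𝓕 ψ : L2R3) =ᵐ[volume] g) (ω : E3) :
    ∀ᵐ ξ ∂(volume : Measure E3), overlap α ψ ξ ω = overlapSum α g ξ ω := by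
  have hp (p : ScaleShear α) : ((shearMatrix (-p.1.2)).transpose *
      scalingMatrix α (-(p.1.1 : ℤ))).det ≠ 0 := by
    rw [← shear_mul_scaling_inv_transpose, Matrix.det_transpose, Matrix.det_nonsing_inv,
      Ring.inverse_eq_inv']
    exact inv_ne_zero (det_shear_mul_scaling_ne_zero α _ _)
  have h1 : ∀ᵐ ξ ∂(volume : Measure E3), ∀ p : ScaleShear α, (𝓕 ψ : L2R3)
      (act ((shearMatrix (-p.1.2)).transpose * scalingMatrix α (-(p.1.1 : ℤ))) ξ - 0) =
      g (act ((shearMatrix (-p.1.2)).transpose * scalingMatrix α (-(p.1.1 : ℤ))) ξ - 0) :=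
    ae_all_iff.2 fun p => (quasiMeasurePreserving_act_sub (hp p) 0).ae h
  have h2 : ∀ᵐ ξ ∂(volume : Measure E3), ∀ p : ScaleShear α, (𝓕 ψ : L2R3)
      (act ((shearMatrix (-p.1.2)).transpose * scalingMatrix α (-(p.1.1 : ℤ))) ξ - -ω) =
      g (act ((shearMatrix (-p.1.2)).transpose * scalingMatrix α (-(p.1.1 : ℤ))) ξ - -ω) :=
    ae_all_iff.2 fun p => (quasiMeasurePreserving_act_sub (hp p) (-ω)).ae h
  filter_upwards [h1, h2] with ξ h3 h4
  simp only [sub_zero, sub_neg_eq_add] at h3 h4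
  exact tsum_congr fun p => by rw [h3 p, h4 p]

theorem maxOverlap_le {α : ℝ} {ψ : L2R3} {g : E3 → ℂ} (h : (𝓕 ψ : L2R3) =ᵐ[volume] g) {ω : E3}
    {X : ℝ≥0∞} (hX : ∀ ξ ∈ pyramid, overlapSum α g ξ ω ≤ X) : maxOverlap α ψ ω ≤ X := by
  refine essSup_le_of_ae_le _ ?_
  filter_upwards [ae_restrict_of_ae (ae_overlap_eq α h ω), ae_restrict_mem measurableSet_pyramid]
    with ξ h1 h2
  rw [h1]
  exact hX ξ h2

theorem le_Linf {α : ℝ} {ψ : L2R3} {g : E3 → ℂ} (h : (𝓕 ψ : L2R3) =ᵐ[volume] g)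
    {X : ℝ≥0∞} (hX : ∀ ξ ∈ pyramid, X ≤ overlapSum α g ξ 0) : X ≤ Linf α ψ := by
  refine le_essInf_of_ae_le _ ?_
  filter_upwards [ae_restrict_of_ae (ae_overlap_eq α h 0), ae_restrict_mem measurableSet_pyramid]
    with ξ h1 h2
  rw [h1]
  exact hX ξ h2

/-- Testing both bounds on `∫ |f̂|² Φ(·, 0)` against a nonzero `f` avoids a separate comparison of
essential infimum and supremum. -/
theorem Linf_ne_top {α : ℝ} {ψ : L2R3} (h : Lsup α ψ ≠ ⊤) : Linf α ψ ≠ ⊤ := by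
  obtain ⟨f, hf, hf0⟩ := exists_mem_pyramidSpace_ne_zero
  have h1 := (le_lintegral_overlap α ψ hf).trans (lintegral_overlap_le α ψ hf 0)
  have hE : ENNReal.ofReal (‖f‖ ^ 2) ≠ 0 := by
    rw [Ne, ENNReal.ofReal_eq_zero, not_le]; positivity
  intro htop
  rw [htop, ENNReal.top_mul hE, top_le_iff] at h1
  exact ENNReal.mul_ne_top h ENNReal.ofReal_ne_top h1

/-- If `R(c) < L_inf` and `L_sup < ∞`, the shearlet system is a frame for the pyramid space, with
optimal bounds controlled by the covering quantities. -/
theorem isFrameFor_and_optimal_bounds {α c₁ c₂ : ℝ} (h₁ : 0 < c₁) (h₂ : 0 < c₂) {ψ : L2R3}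
    (hR : Rsum α c₁ c₂ ψ < Linf α ψ) (hL : Lsup α ψ ≠ ⊤) :
    IsFrameFor pyramidSpace (shearletSystem α c₁ c₂ ψ) ∧
      ∃ A B : ℝ,
        IsGreatest {a | IsLowerFrameBound pyramidSpace (shearletSystem α c₁ c₂ ψ) a} A ∧
        IsLeast {b | IsUpperFrameBound pyramidSpace (shearletSystem α c₁ c₂ ψ) b} B ∧
        ((Linf α ψ).toReal - (Rsum α c₁ c₂ ψ).toReal) / |(samplingMatrix c₁ c₂).det| ≤ A ∧
        A ≤ B ∧
        B ≤ ((Lsup α ψ).toReal + (Rsum α c₁ c₂ ψ).toReal) / |(samplingMatrix c₁ c₂).det| := by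
  have hLi : Linf α ψ ≠ ⊤ := Linf_ne_top hL
  have hRt : Rsum α c₁ c₂ ψ ≠ ⊤ := (hR.trans_le le_top).ne
  obtain ⟨x, hx, hLix⟩ : ∃ x : ℝ, 0 ≤ x ∧ Linf α ψ = ENNReal.ofReal x :=
    ⟨_, ENNReal.toReal_nonneg, (ENNReal.ofReal_toReal hLi).symm⟩
  obtain ⟨y, hy, hLsy⟩ : ∃ y : ℝ, 0 ≤ y ∧ Lsup α ψ = ENNReal.ofReal y :=
    ⟨_, ENNReal.toReal_nonneg, (ENNReal.ofReal_toReal hL).symm⟩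
  obtain ⟨r, hr, hRr⟩ : ∃ r : ℝ, 0 ≤ r ∧ Rsum α c₁ c₂ ψ = ENNReal.ofReal r :=
    ⟨_, ENNReal.toReal_nonneg, (ENNReal.ofReal_toReal hRt).symm⟩
  have hdet : 0 < |(samplingMatrix c₁ c₂).det| := by
    rw [samplingMatrix_det]; positivity
  have hb {f : L2R3} (hf : f ∈ pyramidSpace) := frameSum_bounds h₁.ne' h₂.ne' ψ hf hL hRt
  rw [hLix, hRr] at hR
  rw [hLix, hLsy, hRr] at hb
  rw [hLix, hLsy, hRr, ENNReal.toReal_ofReal hx, ENNReal.toReal_ofReal hy,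
    ENNReal.toReal_ofReal hr]
  set δ := |(samplingMatrix c₁ c₂).det|
  have hrx : r < x := (ENNReal.ofReal_lt_ofReal_iff_of_nonneg hr).1 hR
  have hup : IsUpperFrameBound pyramidSpace (shearletSystem α c₁ c₂ ψ) ((y + r) / δ) := by
    intro f hf
    refine (hb hf).1.trans (le_of_eq ?_)
    rw [← ENNReal.ofReal_add hy hr, ← ENNReal.ofReal_mul (by positivity),
      ← ENNReal.ofReal_mul (by positivity)]
    congr 1; field_simp
  have hlo : IsLowerFrameBound pyramidSpace (shearletSystem α c₁ c₂ ψ) ((x - r) / δ) := by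
    intro f hf
    have h := (hb hf).2
    rw [← ENNReal.ofReal_mul hx, ← ENNReal.ofReal_mul hr, ← ENNReal.ofReal_mul (by positivity),
      ← ENNReal.ofReal_mul (by positivity), ← tsub_le_iff_right,
      ← ENNReal.ofReal_sub _ (by positivity)] at h
    refine le_trans (le_of_eq ?_) h
    congr 1; field_simp
  obtain ⟨f, hf, hf0⟩ := exists_mem_pyramidSpace_ne_zero
  have hpos : 0 < (x - r) / δ := div_pos (by linarith) hdet
  obtain ⟨A, B, hA, hB, h3, h4, h5⟩ := exists_optimal_frameBounds hpos hlo hup hf hf0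
  exact ⟨⟨A, B, hpos.trans_le h3, h4, hA.1, hB.1⟩, A, B, hA, hB, h3, h4, h5⟩

end

end Shearlet

/-! ### Assembly of the theorem and choice of the sampling threshold. -/

open Shearlet in
theorem mainTheorem5 (α : ℝ) (hα : α ∈ Set.Ioc (1 : ℝ) 2)
    (K L : ℕ) (hL : 10 ≤ L) (hKL : 3 * (L : ℝ) / 2 ≤ K) (hKL' : (K : ℝ) ≤ 3 * L - 2)
    (m₀ m₁ φhat : ℝ → ℂ) (hm₀_meas : Measurable m₀) (hm₁_meas : Measurable m₁)
    (hm₀ : IsLowPassFilter K L m₀) (hm₁ : IsBandPassFilter m₀ m₁)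
    (hφhat : IsInfiniteProduct m₀ φhat) :
    (∃ φ : L2R, (𝓕 φ : L2R) =ᵐ[volume] φhat) ∧
    ∃ ψ : L2R3, (𝓕 ψ : L2R3) =ᵐ[volume] generatorFT m₁ φhat ∧
      ∃ c₁_max : ℝ, 0 < c₁_max ∧
        ∀ c₁ c₂ : ℝ, 0 < c₂ → c₂ ≤ c₁ → c₁ ≤ c₁_max →
          IsFrameFor pyramidSpace (shearletSystem α c₁ c₂ ψ) ∧
          Rsum α c₁ c₂ ψ < Linf α ψ ∧ Lsup α ψ < ⊤ ∧
          ∃ A B : ℝ,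
            IsGreatest {a | IsLowerFrameBound pyramidSpace (shearletSystem α c₁ c₂ ψ) a} A ∧
            IsLeast {b | IsUpperFrameBound pyramidSpace (shearletSystem α c₁ c₂ ψ) b} B ∧
            ((Linf α ψ).toReal - (Rsum α c₁ c₂ ψ).toReal) / |(samplingMatrix c₁ c₂).det| ≤ A ∧
            A ≤ B ∧
            B ≤ ((Lsup α ψ).toReal + (Rsum α c₁ c₂ ψ).toReal) /
              |(samplingMatrix c₁ c₂).det| := by
  have hKL2 : 3 * L ≤ 2 * K := by
    have : 3 * (L : ℝ) ≤ 2 * K := by linarith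
    exact_mod_cast this
  have hK : 15 ≤ K := by omega
  have hQ := sum_choose_le hK (by omega : 1 ≤ L) hKL2
  have hφm := hφhat.measurable hm₀_meas
  have hφmem : MemLp φhat 2 volume := memLp_two_of_decay (C := 2 ^ K) volume (by simp) hφm
    fun x => hφhat.norm_le hm₀ hQ (by omega) x
  set g := generatorFT m₁ φhat with hg
  set C : ℝ := 32 ^ K * (2 ^ K) ^ 3 with hC
  have hgle := norm_generatorFT_le hφhat hm₀ hm₁ hQ (by omega : 3 ≤ K)
  have hgmem : MemLp g 2 volume := by
    refine memLp_two_of_decay (C := C) volume (by simp) (measurable_generatorFT hm₁_meas hφm)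
      fun η => (hgle η).trans ?_
    refine mul_le_mul_of_nonneg_left ?_ (by positivity)
    calc _ ≤ 1 * (1 + |η 0|)⁻¹ ^ 3 * (1 + |η 1|)⁻¹ ^ 3 * (1 + |η 2|)⁻¹ ^ 3 := by
          gcongr; exact pow_le_one₀ (by positivity) (min_le_left _ _)
      _ = ((1 + |η 0|) * (1 + |η 1|) * (1 + |η 2|))⁻¹ ^ 3 := by
          rw [one_mul, mul_inv, mul_inv, mul_pow, mul_pow]
      _ ≤ (1 + ‖η‖)⁻¹ ^ 3 := by gcongr; exact one_add_norm_le η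
  refine ⟨exists_fourier_ae_eq hφmem, ?_⟩
  obtain ⟨ψ, hψ⟩ := exists_fourier_ae_eq hgmem
  refine ⟨ψ, hψ, ?_⟩
  have hr1 : (1 : ℝ) < 2 ^ (α / 2) := Real.one_lt_rpow (by norm_num) (by linarith [hα.1])
  set X : ENNReal := ENNReal.ofReal (C ^ 2) * ENNReal.ofReal (2 ^ (α / 2)) *
    geomSum (2 ^ (α / 2)) * (8 * intSum) ^ 2 with hX
  have hXt : X ≠ ⊤ := by
    refine ENNReal.mul_ne_top (ENNReal.mul_ne_top (ENNReal.mul_ne_top ENNReal.ofReal_ne_top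
      ENNReal.ofReal_ne_top) (geomSum_ne_top hr1)) (ENNReal.pow_ne_top ?_)
    exact ENNReal.mul_ne_top (by norm_num) intSum_ne_top
  have hΓ (ω : E3) : maxOverlap α ψ ω ≤ X * ENNReal.ofReal (latticeWeight ω) :=
    maxOverlap_le hψ fun ξ hξ => overlapSum_le (by linarith [hα.1]) (by omega : 5 ≤ K)
      (by positivity) hgle (one_le_abs_of_mem_pyramid hξ) ω
  have hLsup : Lsup α ψ < ⊤ := (hΓ 0).trans_lt (ENNReal.mul_lt_top hXt.lt_top
    ENNReal.ofReal_lt_top)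
  set ε : ℝ := ((1 / 2) ^ K) ^ 4 with hε
  have hε0 : 0 < ε := by positivity
  have hLinf : ENNReal.ofReal (ε ^ 2) ≤ Linf α ψ :=
    le_Linf hψ fun ξ hξ => le_overlapSum hα hε0.le
      (fun η h0 h0' h1 h2 => le_norm_generatorFT hφhat hm₀ hm₁ (by omega) h0 h0' h1 h2) hξ
  set Y : ENNReal := 4 * X * intSum ^ 3 with hY
  have hYt : Y ≠ ⊤ := ENNReal.mul_ne_top (ENNReal.mul_ne_top (by norm_num) hXt)
    (ENNReal.pow_ne_top intSum_ne_top)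
  obtain ⟨y, hy, hYy⟩ : ∃ y : ℝ, 0 ≤ y ∧ Y = ENNReal.ofReal y :=
    ⟨_, ENNReal.toReal_nonneg, (ENNReal.ofReal_toReal hYt).symm⟩
  -- With this threshold `c₁² y ≤ c₁ y < c₁ (y + 1) ≤ ε²`. Using `y + 1` makes the inequality strict
  -- and avoids dividing by zero.
  refine ⟨min 1 (ε ^ 2 / (y + 1)), lt_min one_pos (by positivity), fun c₁ c₂ h₂ h₂₁ h₁ => ?_⟩
  have hc₁ : 0 < c₁ := h₂.trans_le h₂₁
  have hc₁1 : c₁ ≤ 1 := h₁.trans (min_le_left _ _)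
  have hRlt : Rsum α c₁ c₂ ψ < Linf α ψ := by
    refine lt_of_lt_of_le ((Rsum_le hΓ h₂ h₂₁ hc₁1).trans_lt ?_) hLinf
    rw [← hY, hYy, ← ENNReal.ofReal_mul (by positivity)]
    refine (ENNReal.ofReal_lt_ofReal_iff (by positivity)).2 ?_
    have h3 : c₁ * (y + 1) ≤ ε ^ 2 := by
      rw [← le_div_iff₀ (by positivity)]; exact h₁.trans (min_le_right _ _)
    have h4 : c₁ ^ 2 * y ≤ c₁ * y := by
      gcongr
      exact pow_le_of_le_one hc₁.le hc₁1 two_ne_zero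
    nlinarith
  obtain ⟨hframe, hopt⟩ := isFrameFor_and_optimal_bounds hc₁ h₂ hRlt hLsup.ne
  exact ⟨hframe, hRlt, hLsup, hopt⟩
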